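/- Let $M\subset\mathbb C^{n+1}$ be a smooth real hypersurface which is pseudoconvex near $p\in M$. Local holomorphic coordinates centered at $p$ are written $(z,w)=(z_1,\dots,z_n,u+iv)$. A weight is an $n$-tuple of rational numbers $\frac12\ge\lambda_1\ge\dots\ge\lambda_n\ge 0$ such that for each $k$ there are nonnegative integers $l_1,\dots,l_n$ with $l_k>0$ and $\sum_j l_j\lambda_j=1$; the variables $z_j,\bar z_j$ have weight $\lambda_j$ and $u$ has weight $1$. Coordinates $(z,w)$ are $\Lambda$-adapted, with leading polynomial $P$, if in them $M$ is given near $p$ by $v=P(z,\bar z)+o_{wt}(1)$, where $P$ is a real-valued, non-pluriharmonic polynomial, homogeneous of weighted degree $1$, and $o_{wt}(1)$ denotes terms of weight $>1$ in the Taylor expansion of the (smooth) graphing function of $(z,\bar z,u)$. A weight is distinguished if adapted coordinates exist for it. Assume that distinguished weights exist and let $\Lambda_M=(\mu_1,\dots,\mu_n)$ be their infimum in the lexicographic order (among nonincreasing $n$-tuples with entries in $[0,\frac12]$). The Catlin multitype of $M$ at $p$ is $(1/\mu_1,\dots,1/\mu_n)$, where $1/0=\infty$. Assume that all entries of the multitype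 are equal to one even integer $m$, and let $P$ be the leading polynomial in some $\Lambda_M$-adapted coordinates; it is homogeneous of degree $m$ in $(z,\bar z)$. For $c\in\mathbb C^n\setminus\{0\}$ write $$P(\zeta c,\bar\zeta\bar c)=a_0^c|\zeta|^m+\sum_{j=2,4,\dots,m}|\zeta|^{m-j}\operatorname{Re}(a_j^c\zeta^j),\qquad \zeta\in\mathbb C,$$ with $a_0^c\in\mathbb R$ and $a_j^c\in\mathbb C$, and for even $l$ put $$\kappa^l_M=\sup\Big\{\frac{|a_l^c|}{a_0^c}\ :\ c\ne 0,\ a_0^c>0\Big\}.$$ Let $$\gamma_{lm}=\frac{m}{l^2-m}\ \text{ if } l^2\ge 3m-2,\qquad \gamma_{lm}=\sqrt{\frac{(4m-l^2-4)\,m^2}{(4m-4)(m^2-l^2)}}\ \text{ if } l^2<3m-2 .$$ **Proposition 6.1.** If there is an even integer $l$ with $2\le l<m$ such that either $l>\frac m2$ and $\kappa^l_M>\gamma_{lm}$, or $l\le\frac m2$ and $\kappa^l_M>2\gamma_{lm}$, then $M$ is not locally convexifiable at $p$; that is, there are no local holomorphic coordinates centered at $p$ in which $M$ is, near $p$, part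 of the boundary of an open convex set. -/

import Mathlib

open Filter Topology Asymptotics
open scoped ContDiff ENNReal ComplexConjugate

noncomputable section

namespace KohnNirenberg

/-- `ℂ^{n+1} = ℂ^n × ℂ`, with points written `(z, w)`. -/
abbrev CSpace (n : ℕ) : Type := (Fin n → ℂ) × ℂ

/-! ### Pseudoconvex hypersurfaces -/

/-- `ρ` is a smooth local defining function of `M` near `p`. -/
def IsLocalDefiningFunction {n : ℕ} (M : Set (CSpace n)) (p : CSpace n)
    (ρ : CSpace n → ℝ) : Prop :=
  (∀ᶠ q in 𝓝 p, ContDiffAt ℝ ∞ ρ q) ∧ fderiv ℝ ρ p ≠ 0 ∧ ∀ᶠ q in 𝓝 p, (q ∈ M ↔ ρ q = 0)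

/-- The Levi form `∑ ∂²ρ/∂z_j∂z̄_k t_j t̄_k`, written through the real second derivative:
it equals `(D²ρ(t, t) + D²ρ(it, it)) / 4`. -/
def leviForm {n : ℕ} (ρ : CSpace n → ℝ) (q t : CSpace n) : ℝ :=
  (fderiv ℝ (fderiv ℝ ρ) q t t
    + fderiv ℝ (fderiv ℝ ρ) q (Complex.I • t) (Complex.I • t)) / 4

/-- `M` is, near `p`, a smooth pseudoconvex hypersurface: for a suitable (sign of the) defining
function the Levi form is positive semidefinite on the complex tangent space at all points of `M`
near `p`. -/
def IsPseudoconvexAt {n : ℕ} (M : Set (CSpace n)) (p : CSpace n) : Prop :=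
  ∃ ρ : CSpace n → ℝ, IsLocalDefiningFunction M p ρ ∧
    ∀ᶠ q in 𝓝 p, q ∈ M → ∀ t : CSpace n,
      fderiv ℝ ρ q t = 0 → fderiv ℝ ρ q (Complex.I • t) = 0 → 0 ≤ leviForm ρ q t

/-! ### Local holomorphic coordinates and convexifiability -/

/-- A system of local holomorphic coordinates on `ℂ^{n+1}` centered at `p`. -/
structure HolCoords (n : ℕ) (p : CSpace n) where
  /-- the coordinate map -/
  chart : OpenPartialHomeomorph (CSpace n) (CSpace n)
  mem_source : p ∈ chart.source
  map_center : chart p = 0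
  holomorphic : DifferentiableOn ℂ chart chart.source
  holomorphic_symm : DifferentiableOn ℂ chart.symm chart.target

/-- `M` is locally convexifiable at `p`: there are local holomorphic coordinates in which `M`,
near `p`, is the boundary of an open convex set. -/
def IsLocallyConvexifiableAt {n : ℕ} (M : Set (CSpace n)) (p : CSpace n) : Prop :=
  ∃ (Φ : HolCoords n p) (D : Set (CSpace n)), IsOpen D ∧ Convex ℝ D ∧
    ∀ᶠ q in 𝓝 p, (q ∈ M ↔ Φ.chart q ∈ frontier D)

/-- In the coordinates `Φ`, `M` is near `p` the graph `v = Ψ(z, z̄, u)`, `w = u + iv`, of a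
smooth real function. -/
def IsGraphIn {n : ℕ} (M : Set (CSpace n)) (p : CSpace n) (Φ : HolCoords n p)
    (Ψ : (Fin n → ℂ) × ℝ → ℝ) : Prop :=
  (∀ᶠ x in 𝓝 (0 : (Fin n → ℂ) × ℝ), ContDiffAt ℝ ∞ Ψ x) ∧
    ∀ᶠ q in 𝓝 p, (q ∈ M ↔ (Φ.chart q).2.im = Ψ ((Φ.chart q).1, (Φ.chart q).2.re))

/-! ### Polynomials in `z`, `z̄` and `u` -/

/-- Polynomials in `z_1, …, z_n` (variables `inl j`) and `z̄_1, …, z̄_n` (variables `inr j`). -/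
abbrev ZPoly (n : ℕ) : Type := MvPolynomial (Fin n ⊕ Fin n) ℂ

/-- The value `P(z, z̄)`. -/
def ZPoly.val {n : ℕ} (P : ZPoly n) (z : Fin n → ℂ) : ℂ :=
  MvPolynomial.eval (Sum.elim z fun j => conj (z j)) P

/-- `P(z, z̄)` is real valued. -/
def ZPoly.IsReal {n : ℕ} (P : ZPoly n) : Prop := ∀ z, (P.val z).im = 0

/-- `P` is pluriharmonic: `∂²P/∂z_j∂z̄_k = 0` for all `j, k`. -/
def ZPoly.IsPluriharmonic {n : ℕ} (P : ZPoly n) : Prop :=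
  ∀ j k : Fin n, MvPolynomial.pderiv (Sum.inl j) (MvPolynomial.pderiv (Sum.inr k) P) = 0

/-- Polynomials in `z`, `z̄` and one further variable `u`. -/
abbrev ZUPoly (n : ℕ) : Type := MvPolynomial ((Fin n ⊕ Fin n) ⊕ Unit) ℂ

/-- The value `R(z, z̄, u)`. -/
def ZUPoly.val {n : ℕ} (R : ZUPoly n) (x : (Fin n → ℂ) × ℝ) : ℂ :=
  MvPolynomial.eval
    (Sum.elim (Sum.elim x.1 fun j => conj (x.1 j)) fun _ => (x.2 : ℂ)) R

/-! ### Weights and the Catlin multitype -/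

/-- Weight of the variables `z_j`, `z̄_j`. -/
def zWeight {n : ℕ} (Λ : Fin n → ℝ) : Fin n ⊕ Fin n → ℝ := Sum.elim Λ Λ

/-- Weight of the variables `z_j`, `z̄_j`, `u`; the variable `u` has weight one. -/
def zuWeight {n : ℕ} (Λ : Fin n → ℝ) : (Fin n ⊕ Fin n) ⊕ Unit → ℝ :=
  Sum.elim (zWeight Λ) fun _ => 1

/-- Nonincreasing tuples with entries in `[0, 1/2]`. -/
def IsWeightTuple {n : ℕ} (Λ : Fin n → ℝ) : Prop :=
  (∀ j, 0 ≤ Λ j ∧ Λ j ≤ 1 / 2) ∧ Antitone Λ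

/-- A weight: a nonincreasing tuple of rational numbers in `[0, 1/2]` such that for each `k` there
are nonnegative integers `l_1, …, l_n` with `l_k > 0` and `∑ l_j λ_j = 1`. -/
def IsWeight {n : ℕ} (Λ : Fin n → ℝ) : Prop :=
  IsWeightTuple Λ ∧ (∀ j, ∃ r : ℚ, Λ j = r) ∧
    ∀ k, ∃ l : Fin n → ℕ, 0 < l k ∧ ∑ j, (l j : ℝ) * Λ j = 1

/-- `Ψ = P + o_wt(1)`: all terms in the Taylor expansion of `Ψ - P` at the origin have weight
greater than one. That is, for every order `k` the function `Ψ - P` agrees up to `o(|(z,u)|^k)`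
with a polynomial all of whose monomials have weight greater than one. -/
def IsLeadingPart {n : ℕ} (Λ : Fin n → ℝ) (Ψ : (Fin n → ℂ) × ℝ → ℝ) (P : ZPoly n) : Prop :=
  ∀ k : ℕ, ∃ R : ZUPoly n,
    (∀ d ∈ R.support, 1 < Finsupp.weight (zuWeight Λ) d) ∧
    (fun x : (Fin n → ℂ) × ℝ => (Ψ x : ℂ) - P.val x.1 - R.val x)
      =o[𝓝 0] fun x => ‖x‖ ^ k

/-- The coordinates `Φ` are `Λ`-adapted with leading polynomial `P`: in them `M` is given by
`v = P(z, z̄) + o_wt(1)`, with `P` a real valued polynomial, `Λ`-homogeneous of weighted degree one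
and not pluriharmonic. -/
def IsAdapted {n : ℕ} (M : Set (CSpace n)) (p : CSpace n) (Λ : Fin n → ℝ)
    (Φ : HolCoords n p) (P : ZPoly n) : Prop :=
  P.IsReal ∧ MvPolynomial.IsWeightedHomogeneous (zWeight Λ) P 1 ∧ ¬ P.IsPluriharmonic ∧
    ∃ Ψ : (Fin n → ℂ) × ℝ → ℝ, IsGraphIn M p Φ Ψ ∧ IsLeadingPart Λ Ψ P

/-- A weight is distinguished if there exist coordinates adapted to it. -/
def IsDistinguished {n : ℕ} (M : Set (CSpace n)) (p : CSpace n) (Λ : Fin n → ℝ) : Prop :=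
  IsWeight Λ ∧ ∃ (Φ : HolCoords n p) (P : ZPoly n), IsAdapted M p Λ Φ P

/-- `Λ` is at most every distinguished weight, in the lexicographic order. -/
def IsLexLowerBound {n : ℕ} (M : Set (CSpace n)) (p : CSpace n) (Λ : Fin n → ℝ) : Prop :=
  ∀ Λ', IsDistinguished M p Λ' → toLex Λ ≤ toLex Λ'

/-- `Λ` is the multitype weight: distinguished weights exist, and `Λ` is their infimum with respect
to the lexicographic order (among nonincreasing tuples with entries in `[0, 1/2]`). -/
def IsMultitypeWeight {n : ℕ} (M : Set (CSpace n)) (p : CSpace n) (Λ : Fin n → ℝ) : Prop :=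
  (∃ Λ', IsDistinguished M p Λ') ∧ IsWeightTuple Λ ∧ IsLexLowerBound M p Λ ∧
    ∀ Λ', IsWeightTuple Λ' → IsLexLowerBound M p Λ' → toLex Λ' ≤ toLex Λ

/-- `M` has Catlin multitype `(m_1, …, m_n)` at `p`: `m_j` is the inverse of the `j`-th component
of the multitype weight, and `∞` if that component vanishes. -/
def HasMultitype {n : ℕ} (M : Set (CSpace n)) (p : CSpace n) (m : Fin n → ℝ≥0∞) : Prop :=
  ∃ Λ : Fin n → ℝ, IsMultitypeWeight M p Λ ∧ ∀ j, m j = (ENNReal.ofReal (Λ j))⁻¹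

/-! ### Kohn-Nirenberg numbers -/

/-- The restriction `P_c(ζ) = P(ζc, ζ̄c̄)` of `P` to the complex line spanned by `c`, as a
polynomial in `ζ` (variable `0`) and `ζ̄` (variable `1`). -/
def ZPoly.restrict {n : ℕ} (P : ZPoly n) (c : Fin n → ℂ) : MvPolynomial (Fin 2) ℂ :=
  MvPolynomial.aeval
    (Sum.elim (fun j => MvPolynomial.C (c j) * MvPolynomial.X 0)
      fun j => MvPolynomial.C (conj (c j)) * MvPolynomial.X 1) P

/-- The coefficient of `ζ^a ζ̄^b` in `P_c`. -/
def ZPoly.lineCoeff {n : ℕ} (P : ZPoly n) (c : Fin n → ℂ) (a b : ℕ) : ℂ :=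
  MvPolynomial.coeff (Finsupp.single 0 a + Finsupp.single 1 b) (P.restrict c)

/-- The coefficient `a_0^c` in
`P_c(ζ) = a_0^c |ζ|^m + ∑_{j = 2, 4, …, m} |ζ|^{m-j} Re(a_j^c ζ^j)`. -/
def ZPoly.a₀ {n : ℕ} (P : ZPoly n) (m : ℕ) (c : Fin n → ℂ) : ℝ :=
  (P.lineCoeff c (m / 2) (m / 2)).re

/-- The coefficient `a_l^c` (for even `l` with `2 ≤ l ≤ m`, `m` even) in
`P_c(ζ) = a_0^c |ζ|^m + ∑_{j = 2, 4, …, m} |ζ|^{m-j} Re(a_j^c ζ^j)`: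
as `|ζ|^{m-l} Re(a ζ^l) = (a/2) ζ^{(m+l)/2} ζ̄^{(m-l)/2} + (ā/2) ζ^{(m-l)/2} ζ̄^{(m+l)/2}`,
it is twice the coefficient of `ζ^{(m+l)/2} ζ̄^{(m-l)/2}`. -/
def ZPoly.aCoeff {n : ℕ} (P : ZPoly n) (m l : ℕ) (c : Fin n → ℂ) : ℂ :=
  2 * P.lineCoeff c ((m + l) / 2) ((m - l) / 2)

/-- The Kohn-Nirenberg number `κ^l = sup_c |a_l^c| / a_0^c`, as an extended real number; the
supremum is over the nonzero vectors `c` for which the denominator is positive. -/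
def kappa {n : ℕ} (P : ZPoly n) (m l : ℕ) : EReal :=
  ⨆ (c : Fin n → ℂ) (_ : c ≠ 0) (_ : 0 < P.a₀ m c),
    ((‖P.aCoeff m l c‖ / P.a₀ m c : ℝ) : EReal)

/-- The constants `γ_{lk}`. -/
def gammaKN (l k : ℕ) : ℝ :=
  if 3 * (k : ℝ) - 2 ≤ (l : ℝ) ^ 2 then (k : ℝ) / ((l : ℝ) ^ 2 - k)
  else √(((4 * (k : ℝ) - (l : ℝ) ^ 2 - 4) * (k : ℝ) ^ 2) /
    ((4 * (k : ℝ) - 4) * ((k : ℝ) ^ 2 - (l : ℝ) ^ 2)))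

end KohnNirenberg

end

namespace KohnNirenberg

/-! ### The extremal problem for two frequencies -/

/-! Suppose `M` becomes the boundary of a convex domain `D`. A supporting hyperplane of `D` at the
origin gives a complex linear functional ℓ with Im ℓ > 0 on `D`. In the adapted coordinates ℓ
becomes a holomorphic G with Im G ≥ 0 on `M`. Under z ↦ εz, w ↦ ε^m w the hypersurface tends to v =
P. Positivity on `M` bounds Im G(z, 0) below by -O(|ε|^m) on rays, which kills the pure z-terms of
degree < m. Hence G has weighted leading part A w + b(z) with A real and nonzero and b(ζc) = ζ^m
b(c) (`exists_support_function_expansion`). Midpoints of boundary points stay in the closure of `D`.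
Reading this through G in the scaled limit shows that Q = A P + Im b is midpoint convex when A > 0
(`exists_convex_leading_polynomial`).

On a complex line ℂc the term Im b only affects frequency m, so the mean and the frequencies l < m
of Q are A times those of P. Since Q ≥ 0, a positive a_0^c forces A > 0. On the unit circle the
Hessian of Q, in a direction turning with the point, is a nonnegative trigonometric polynomial.
Averaging keeps only its mean and frequency l: with full amplitude if 2l > m
(`re_add_add_nonneg_of_lt`), with half amplitude in general (`two_re_add_add_nonneg`). What remains
is a multiple of the Hessian of r^m (1 + K cos lθ), and its positivity forces K ≤ γ_{lm}
(`le_gammaKN_of_hessian_nonneg`). So |a_l^c| / a_0^c is at most γ_{lm}, respectively 2γ_{lm}, for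
every admissible c, which contradicts the assumption on κ^l.

The intermediate lemmas use halved indices: m = 2μ, frequency 2l, and the circle variable η = u². -/

theorem sq_le_mul_of_forall_quadratic_nonneg {A B D : ℝ}
    (h : ∀ x y : ℝ, 0 ≤ A * x ^ 2 + 2 * B * x * y + D * y ^ 2) : B ^ 2 ≤ A * D := by
  have h1 := discrim_le_zero (a := A) (b := 2 * B) (c := D) fun x => by
    have := h x 1
    nlinarith
  unfold discrim at h1
  nlinarith

/-- If the Hessian of `r ^ m * (1 + K cos (l θ))` is nonnegative, then `K ≤ γ_{lm}`. -/
theorem le_gammaKN_of_hessian_nonneg {l m : ℕ} (hl : 2 ≤ l) (hlm : l < m) {K : ℝ}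
    (h : ∀ c s x y : ℝ, c ^ 2 + s ^ 2 = 1 →
      0 ≤ (m * (m - 1) * (1 + K * c)) * x ^ 2 + 2 * (-(K * l * (m - 1) * s)) * x * y
        + (m + (m - (l : ℝ) ^ 2) * (K * c)) * y ^ 2) :
    K ≤ gammaKN l m := by
  have hl' : (2 : ℝ) ≤ l := by exact_mod_cast hl
  have hlm' : (l : ℝ) + 1 ≤ m := by exact_mod_cast hlm
  unfold gammaKN
  generalize (l : ℝ) = L at *
  generalize (m : ℝ) = N at *
  have hdet : ∀ c s : ℝ, c ^ 2 + s ^ 2 = 1 → (K * L * (N - 1) * s) ^ 2 ≤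
      (N * (N - 1) * (1 + K * c)) * (N + (N - L ^ 2) * (K * c)) := fun c s hcs => by
    have := sq_le_mul_of_forall_quadratic_nonneg (h c s · · hcs)
    rwa [neg_sq] at this
  split_ifs with hc
  -- For large l the tangential second derivative at the maximum of the cosine is already decisive.
  · have hpos : 0 < L ^ 2 - N := by linarith
    rw [le_div_iff₀ hpos]
    have := h 1 0 0 1 (by norm_num)
    linarith
  · rw [not_le] at hc
    by_contra! hK
    have hNL : 0 < N ^ 2 - L ^ 2 := by nlinarith
    have hK0 : 0 < K := (Real.sqrt_nonneg _).trans_lt hK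
    have hK2 : (4 * N - L ^ 2 - 4) * N ^ 2 < K ^ 2 * ((4 * N - 4) * (N ^ 2 - L ^ 2)) := by
      rw [Real.sqrt_lt' hK0, div_lt_iff₀ (by apply mul_pos <;> linarith)] at hK
      exact hK
    -- With e = K c, the determinant condition reads L²(N-1)K² ≤ N² + N(2N-L²)e + (N²-L²)e². This
    -- `c` puts e at the vertex of the quadratic on the right, where the condition is strongest.
    set c : ℝ := -(N * (2 * N - L ^ 2)) / (2 * (N ^ 2 - L ^ 2) * K) with hcdef
    have hcmul : 2 * (N ^ 2 - L ^ 2) * (K * c) = -(N * (2 * N - L ^ 2)) := by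
      rw [hcdef]; field_simp
    set e : ℝ := K * c with he
    -- The difference of the two sides is exactly L²(N-2)(3N-2-L²). This is where L² < 3N-2 ensures
    -- that the vertex is attained by a genuine cosine, |c| ≤ 1.
    have key : (N - 1) * (2 * N - L ^ 2) ^ 2 ≤ (4 * N - 4 - L ^ 2) * (N ^ 2 - L ^ 2) := by
      have : 0 ≤ L ^ 2 * ((N - 2) * (3 * N - 2 - L ^ 2)) := by
        apply mul_nonneg (sq_nonneg _)
        apply mul_nonneg <;> linarith
      nlinarith
    have he2 : e ^ 2 ≤ K ^ 2 := by
      have h1 : (2 * (N ^ 2 - L ^ 2)) ^ 2 * e ^ 2 = N ^ 2 * (2 * N - L ^ 2) ^ 2 := by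
        rw [← mul_pow, hcmul]; ring
      have h2 : (N - 1) * ((2 * (N ^ 2 - L ^ 2)) ^ 2 * e ^ 2) ≤
          (N - 1) * ((2 * (N ^ 2 - L ^ 2)) ^ 2 * K ^ 2) := by
        rw [h1]
        calc (N - 1) * (N ^ 2 * (2 * N - L ^ 2) ^ 2)
            = N ^ 2 * ((N - 1) * (2 * N - L ^ 2) ^ 2) := by ring
          _ ≤ N ^ 2 * ((4 * N - 4 - L ^ 2) * (N ^ 2 - L ^ 2)) := by gcongr
          _ = ((4 * N - L ^ 2 - 4) * N ^ 2) * (N ^ 2 - L ^ 2) := by ring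
          _ ≤ (K ^ 2 * ((4 * N - 4) * (N ^ 2 - L ^ 2))) * (N ^ 2 - L ^ 2) := by gcongr
          _ = _ := by ring
      have h3 : 0 < (N - 1) * (2 * (N ^ 2 - L ^ 2)) ^ 2 := by
        apply mul_pos <;> [linarith; positivity]
      rw [← mul_assoc, ← mul_assoc] at h2
      exact le_of_mul_le_mul_left h2 h3
    have hc1 : c ^ 2 ≤ 1 := by
      rw [he, mul_pow] at he2
      exact le_of_mul_le_mul_left (by linarith) (pow_pos hK0 2)
    have hd := hdet c (√(1 - c ^ 2)) (by rw [Real.sq_sqrt (by linarith)]; ring)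
    rw [mul_pow, Real.sq_sqrt (by linarith)] at hd
    have hd' : L ^ 2 * (N - 1) * (K ^ 2 - e ^ 2) ≤ N * (1 + e) * (N + (N - L ^ 2) * e) := by
      have h3 : (N - 1) * (L ^ 2 * (N - 1) * (K ^ 2 - e ^ 2)) ≤
          (N - 1) * (N * (1 + e) * (N + (N - L ^ 2) * e)) := by
        have hdiff : (K * L * (N - 1)) ^ 2 * (1 - c ^ 2) =
            (N - 1) * (L ^ 2 * (N - 1) * (K ^ 2 - e ^ 2)) := by rw [he]; ring
        rw [← he, hdiff] at hd
        linarith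
      exact le_of_mul_le_mul_left h3 (by linarith)
    -- The determinant condition at the vertex, multiplied by 4(N²-L²); it amounts to K² ≤ γ².
    have h4 : L ^ 2 * (N - 1) * K ^ 2 * (4 * (N ^ 2 - L ^ 2)) ≤
        4 * N ^ 2 * (N ^ 2 - L ^ 2) - N ^ 2 * (2 * N - L ^ 2) ^ 2 := by
      have h5 : L ^ 2 * (N - 1) * K ^ 2 ≤
          N ^ 2 + N * (2 * N - L ^ 2) * e + (N ^ 2 - L ^ 2) * e ^ 2 := by linarith
      have h6 := mul_le_mul_of_nonneg_right h5 (show 0 ≤ 4 * (N ^ 2 - L ^ 2) by linarith)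
      have h7 : (N ^ 2 + N * (2 * N - L ^ 2) * e + (N ^ 2 - L ^ 2) * e ^ 2) * (4 * (N ^ 2 - L ^ 2))
          = 4 * N ^ 2 * (N ^ 2 - L ^ 2) + 2 * (N * (2 * N - L ^ 2)) * (2 * (N ^ 2 - L ^ 2) * e)
            + (2 * (N ^ 2 - L ^ 2) * e) ^ 2 := by ring
      rw [h7, hcmul] at h6
      linarith
    have h8 : 4 * N ^ 2 * (N ^ 2 - L ^ 2) - N ^ 2 * (2 * N - L ^ 2) ^ 2
        = L ^ 2 * ((4 * N - L ^ 2 - 4) * N ^ 2) := by ring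
    rw [h8] at h4
    have h9 : L ^ 2 * ((4 * N - L ^ 2 - 4) * N ^ 2) <
        L ^ 2 * (K ^ 2 * ((4 * N - 4) * (N ^ 2 - L ^ 2))) := by
      apply mul_lt_mul_of_pos_left hK2; positivity
    linarith

/-! ### Averaging over roots of unity -/

theorem sum_range_pow_zpow_eq {N : ℕ} {ξ : ℂ} (hξ : IsPrimitiveRoot ξ N) (j : ℤ) :
    ∑ k ∈ Finset.range N, (ξ ^ k) ^ j = if (N : ℤ) ∣ j then (N : ℂ) else 0 := by
  have h0 : ∀ k : ℕ, (ξ ^ k) ^ j = (ξ ^ j) ^ k := fun k => by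
    rw [← zpow_natCast, ← zpow_natCast, ← zpow_mul, ← zpow_mul, mul_comm]
  simp_rw [h0]
  split_ifs with h
  · rw [(hξ.zpow_eq_one_iff_dvd j).2 h]; simp
  · have h1 : ξ ^ j ≠ 1 := fun h2 => h ((hξ.zpow_eq_one_iff_dvd j).1 h2)
    rw [geom_sum_eq h1, ← zpow_natCast, ← zpow_mul, mul_comm, zpow_mul, zpow_natCast, hξ.pow_eq_one]
    simp

/-- A nonnegative trigonometric polynomial of degree `< 2 l` remains nonnegative when only the
frequencies `0` and `±l` are kept. -/
theorem re_add_add_nonneg_of_lt {μ l : ℕ} (hl : 0 < l) (hlμ : l ≤ μ) (hμ : μ < 2 * l) (e : ℕ → ℂ)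
    (h : ∀ η : ℂ, ‖η‖ = 1 → 0 ≤ (∑ a ∈ Finset.range (2 * μ + 1), e a * η ^ ((a : ℤ) - μ)).re)
    (u : ℂ) (hu : ‖u‖ = 1) :
    0 ≤ (e μ + e (μ + l) * u ^ (l : ℤ) + e (μ - l) * u ^ (-(l : ℤ))).re := by
  have hξ := Complex.isPrimitiveRoot_exp l hl.ne'
  set ξ := Complex.exp (2 * Real.pi * Complex.I / l)
  have hξn : ‖ξ‖ = 1 := hξ.norm'_eq_one hl.ne'
  -- Averaging over rotations by l-th roots of unity keeps the frequencies divisible by l. Those in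
  -- [-μ, μ] are 0 and ±l because μ < 2l.
  have h1 : 0 ≤ (∑ k ∈ Finset.range l,
      ∑ a ∈ Finset.range (2 * μ + 1), e a * (u * ξ ^ k) ^ ((a : ℤ) - μ)).re := by
    rw [Complex.re_sum]
    exact Finset.sum_nonneg fun k _ => h _ (by simp [hu, hξn])
  rw [Finset.sum_comm] at h1
  have h2 : ∀ a ∈ Finset.range (2 * μ + 1),
      ∑ k ∈ Finset.range l, e a * (u * ξ ^ k) ^ ((a : ℤ) - μ) =
      (l : ℂ) * ((if a = μ then e μ else 0)
        + (if a = μ + l then e (μ + l) * u ^ (l : ℤ) else 0)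
        + (if a = μ - l then e (μ - l) * u ^ (-(l : ℤ)) else 0)) := by
    intro a ha
    rw [Finset.mem_range] at ha
    simp_rw [mul_zpow, ← mul_assoc]
    rw [← Finset.mul_sum, sum_range_pow_zpow_eq hξ]
    by_cases h0 : a = μ
    · subst h0
      rw [if_pos (by simp), if_pos rfl, if_neg (by omega), if_neg (by omega)]
      simp [mul_comm]
    · by_cases hp : a = μ + l
      · subst hp
        rw [if_pos (by simp), if_neg (by omega), if_pos rfl, if_neg (by omega)]
        push_cast
        rw [add_sub_cancel_left]
        simp [mul_comm]
      · by_cases hq : a = μ - l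
        · subst hq
          have : ((μ - l : ℕ) : ℤ) - μ = -l := by omega
          rw [this, if_pos (by simp), if_neg (by omega), if_neg (by omega), if_pos rfl]
          ring
        · rw [if_neg, if_neg h0, if_neg hp, if_neg hq]
          · simp
          · rintro ⟨t, ht⟩
            have ht1 : t < 2 := by
              by_contra! h
              nlinarith
            have ht2 : -2 < t := by
              by_contra! h
              nlinarith
            interval_cases t <;> omega
  rw [Finset.sum_congr rfl h2, ← Finset.mul_sum, Finset.sum_add_distrib, Finset.sum_add_distrib,
    Finset.sum_ite_eq', Finset.sum_ite_eq', Finset.sum_ite_eq', if_pos (by simp; omega),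
    if_pos (by simp; omega), if_pos (by simp; omega)] at h1
  rw [show (l : ℂ) = ((l : ℝ) : ℂ) by simp, Complex.re_ofReal_mul] at h1
  exact nonneg_of_mul_nonneg_right h1 (by exact_mod_cast hl)

/-- Convolution of a nonnegative trigonometric polynomial with `1 + cos (l θ)`. -/
theorem two_re_add_add_nonneg {μ l : ℕ} (hl : 0 < l) (hlμ : l ≤ μ) (e : ℕ → ℂ)
    (h : ∀ η : ℂ, ‖η‖ = 1 → 0 ≤ (∑ a ∈ Finset.range (2 * μ + 1), e a * η ^ ((a : ℤ) - μ)).re)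
    (u : ℂ) (hu : ‖u‖ = 1) :
    0 ≤ (2 * e μ + e (μ + l) * u ^ (l : ℤ) + e (μ - l) * u ^ (-(l : ℤ))).re := by
  set N := 2 * μ + 1
  have hN0 : N ≠ 0 := by omega
  have hξ := Complex.isPrimitiveRoot_exp N hN0
  set ξ := Complex.exp (2 * Real.pi * Complex.I / N)
  have hξn : ‖ξ‖ = 1 := hξ.norm'_eq_one hN0
  have hξ0 : ξ ≠ 0 := by rw [← norm_ne_zero_iff, hξn]; exact one_ne_zero
  -- The kernel 2 + 2 cos(lθ) is nonnegative, so weighting by it preserves nonnegativity.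
  have hker : ∀ k : ℕ, ∃ r : ℝ, 0 ≤ r ∧
      (2 + (ξ ^ k) ^ (l : ℤ) + (ξ ^ k) ^ (-(l : ℤ)) : ℂ) = (r : ℂ) := by
    intro k
    have hn : ‖(ξ ^ k) ^ l‖ = 1 := by simp [hξn]
    refine ⟨2 + 2 * ((ξ ^ k) ^ l).re, ?_, ?_⟩
    · have := (abs_le.1 (Complex.abs_re_le_norm ((ξ ^ k) ^ l))).1
      linarith
    · rw [zpow_neg, zpow_natCast, Complex.inv_eq_conj hn, add_assoc, Complex.add_conj]
      push_cast; ring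
  have h1 : 0 ≤ (∑ k ∈ Finset.range N, (2 + (ξ ^ k) ^ (l : ℤ) + (ξ ^ k) ^ (-(l : ℤ))) *
      ∑ a ∈ Finset.range N, e a * (u * ξ ^ k) ^ ((a : ℤ) - μ)).re := by
    rw [Complex.re_sum]
    refine Finset.sum_nonneg fun k _ => ?_
    obtain ⟨r, hr, hr'⟩ := hker k
    rw [hr', Complex.re_ofReal_mul]
    exact mul_nonneg hr (h _ (by simp [hu, hξn]))
  simp_rw [Finset.mul_sum] at h1
  rw [Finset.sum_comm] at h1
  have h2 : ∀ a ∈ Finset.range N,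
      ∑ k ∈ Finset.range N, (2 + (ξ ^ k) ^ (l : ℤ) + (ξ ^ k) ^ (-(l : ℤ))) *
        (e a * (u * ξ ^ k) ^ ((a : ℤ) - μ)) =
      (N : ℂ) * ((if a = μ then 2 * e μ else 0)
        + (if a = μ + l then e (μ + l) * u ^ (l : ℤ) else 0)
        + (if a = μ - l then e (μ - l) * u ^ (-(l : ℤ)) else 0)) := by
    intro a ha
    rw [Finset.mem_range] at ha
    have h3 : ∀ k ∈ Finset.range N, (2 + (ξ ^ k) ^ (l : ℤ) + (ξ ^ k) ^ (-(l : ℤ))) *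
        (e a * (u * ξ ^ k) ^ ((a : ℤ) - μ)) = e a * u ^ ((a : ℤ) - μ) *
        (2 * (ξ ^ k) ^ ((a : ℤ) - μ) + (ξ ^ k) ^ ((a : ℤ) - μ + l)
          + (ξ ^ k) ^ ((a : ℤ) - μ + -l)) := fun k _ => by
      have hk0 : ξ ^ k ≠ 0 := pow_ne_zero _ hξ0
      rw [mul_zpow, zpow_add₀ hk0, zpow_add₀ hk0]
      ring
    rw [Finset.sum_congr rfl h3, ← Finset.mul_sum, Finset.sum_add_distrib, Finset.sum_add_distrib,
      ← Finset.mul_sum, sum_range_pow_zpow_eq hξ, sum_range_pow_zpow_eq hξ,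
      sum_range_pow_zpow_eq hξ]
    -- After multiplication by the kernel the frequencies lie in [-2μ, 2μ], so sampling at 2μ+1
    -- points produces no aliasing: only frequency 0 survives.
    have hdvd : ∀ j : ℤ, -(2 * μ) ≤ j → j ≤ 2 * μ → ((N : ℤ) ∣ j ↔ j = 0) := fun j h1 h2 => by
      constructor
      · intro h
        refine Int.eq_zero_of_abs_lt_dvd h ?_
        rw [abs_lt]; omega
      · rintro rfl; simp
    simp only [hdvd ((a : ℤ) - μ) (by omega) (by omega),
      hdvd ((a : ℤ) - μ + l) (by omega) (by omega), hdvd ((a : ℤ) - μ + -l) (by omega) (by omega)]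
    by_cases h0 : a = μ
    · subst h0
      rw [if_pos (by simp), if_neg (by omega), if_neg (by omega), if_pos rfl, if_neg (by omega),
        if_neg (by omega)]
      simp
      ring
    · by_cases hp : a = μ + l
      · subst hp
        rw [if_neg (by omega), if_neg (by omega), if_pos (by omega), if_neg (by omega), if_pos rfl,
          if_neg (by omega)]
        push_cast
        rw [add_sub_cancel_left]
        ring
      · by_cases hq : a = μ - l
        · subst hq
          have : ((μ - l : ℕ) : ℤ) - μ = -l := by omega
          rw [this, if_neg (by omega), if_pos (by omega), if_neg (by omega), if_neg (by omega),
            if_neg (by omega), if_pos rfl]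
          ring
        · rw [if_neg (by omega), if_neg (by omega), if_neg (by omega), if_neg h0, if_neg hp,
            if_neg hq]
          simp
  rw [Finset.sum_congr rfl h2, ← Finset.mul_sum, Finset.sum_add_distrib, Finset.sum_add_distrib,
    Finset.sum_ite_eq', Finset.sum_ite_eq', Finset.sum_ite_eq', if_pos (by simp; omega),
    if_pos (by simp; omega), if_pos (by simp; omega)] at h1
  rw [show (N : ℂ) = ((N : ℝ) : ℂ) by simp, Complex.re_ofReal_mul] at h1
  exact nonneg_of_mul_nonneg_right h1 (by exact_mod_cast Nat.pos_of_ne_zero hN0)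

/-- Taking l = μ at points with u^μ = 1 and u^μ = -1 and adding cancels the oscillating terms. -/
theorem re_zero_frequency_nonneg {μ : ℕ} (hμ : 0 < μ) (e : ℕ → ℂ)
    (h : ∀ η : ℂ, ‖η‖ = 1 → 0 ≤ (∑ a ∈ Finset.range (2 * μ + 1), e a * η ^ ((a : ℤ) - μ)).re) :
    0 ≤ (e μ).re := by
  have h1 := two_re_add_add_nonneg hμ le_rfl e h 1 (by simp)
  have h2 := two_re_add_add_nonneg hμ le_rfl e h (Complex.exp (Real.pi * Complex.I / μ))
    (by rw [mul_div_right_comm, show (Real.pi / μ : ℂ) = ((Real.pi / μ : ℝ) : ℂ) by simp]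
        exact Complex.norm_exp_ofReal_mul_I _)
  have h3 : Complex.exp (Real.pi * Complex.I / μ) ^ μ = -1 := by
    rw [← Complex.exp_nat_mul, mul_div_cancel₀ _ (by exact_mod_cast hμ.ne'), Complex.exp_pi_mul_I]
  rw [zpow_neg, zpow_natCast, h3] at h2
  simp at h1 h2
  linarith

/-! ### Second differences of a homogeneous polynomial on a line -/

/-- The second derivative of `ζ ^ a * conj ζ ^ b` at `1` in the direction `t`. -/
def monoHessian (a b : ℕ) (t : ℂ) : ℂ :=
  a * (a - 1) * t ^ 2 + 2 * a * b * (t * conj t) + b * (b - 1) * conj t ^ 2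

theorem exists_one_add_mul_pow_eq (t : ℂ) (a : ℕ) : ∃ R : ℝ → ℂ, Continuous R ∧
    ∀ τ : ℝ, (1 + τ * t) ^ a = 1 + a * t * τ + a * (a - 1) / 2 * t ^ 2 * τ ^ 2 + R τ * τ ^ 3 := by
  induction a with
  | zero => exact ⟨fun _ => 0, continuous_const, fun τ => by simp⟩
  | succ a ih =>
    obtain ⟨R, hR, h⟩ := ih
    refine ⟨fun τ => R τ * (1 + τ * t) + a * (a - 1) / 2 * t ^ 3, by fun_prop, fun τ => ?_⟩
    rw [pow_succ, h]
    push_cast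
    ring

/-- The first-order terms of the expansion cancel between τ and -τ, and the cubic remainder is
negligible after division by τ². -/
theorem tendsto_second_difference_mono (t : ℂ) (a b : ℕ) :
    Tendsto (fun τ : ℝ => ((1 + τ * t) ^ a * conj (1 + τ * t) ^ b
      + (1 - τ * t) ^ a * conj (1 - τ * t) ^ b - 2) / (τ : ℂ) ^ 2) (𝓝[>] 0)
      (𝓝 (monoHessian a b t)) := by
  obtain ⟨R, hR, h⟩ := exists_one_add_mul_pow_eq t a
  obtain ⟨S, hS, h'⟩ := exists_one_add_mul_pow_eq (conj t) b
  let Q : ℝ → ℂ := fun τ => R τ * (1 + b * conj t * τ + b * (b - 1) / 2 * conj t ^ 2 * τ ^ 2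
      + S τ * τ ^ 3) + S τ * (1 + a * t * τ + a * (a - 1) / 2 * t ^ 2 * τ ^ 2)
      + a * t * (b * (b - 1) / 2 * conj t ^ 2) + a * (a - 1) / 2 * t ^ 2 * (b * conj t)
      + τ * (a * (a - 1) / 2 * t ^ 2 * (b * (b - 1) / 2 * conj t ^ 2))
  have hQ : Continuous Q := by fun_prop
  have hprod : ∀ τ : ℝ, (1 + τ * t) ^ a * conj (1 + τ * t) ^ b =
      1 + (a * t + b * conj t) * τ + monoHessian a b t / 2 * τ ^ 2 + Q τ * τ ^ 3 := fun τ => by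
    rw [map_add, map_one, map_mul, Complex.conj_ofReal, h, h']
    simp only [Q, monoHessian]
    ring
  have hlim : Tendsto (fun τ : ℝ => monoHessian a b t + (Q τ - Q (-τ)) * τ) (𝓝[>] 0)
      (𝓝 (monoHessian a b t)) := by
    have hc : Continuous fun τ : ℝ => monoHessian a b t + (Q τ - Q (-τ)) * τ := by fun_prop
    have := hc.tendsto 0
    simp only [neg_zero, sub_self, Complex.ofReal_zero, mul_zero, add_zero] at this
    exact this.mono_left nhdsWithin_le_nhds
  refine hlim.congr' ?_
  filter_upwards [self_mem_nhdsWithin] with τ hτ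
  have hτ0 : (τ : ℂ) ≠ 0 := by exact_mod_cast (ne_of_gt hτ)
  have h1 := hprod τ
  have h2 := hprod (-τ)
  rw [Complex.ofReal_neg, neg_mul, ← sub_eq_add_neg] at h2
  rw [h1, h2]
  field_simp
  ring

/-- The real function `Re ∑ C_a ζ ^ a * conj ζ ^ (m - a)`. -/
def lineFun (m : ℕ) (C : ℕ → ℂ) (ζ : ℂ) : ℝ :=
  (∑ a ∈ Finset.range (m + 1), C a * (ζ ^ a * conj ζ ^ (m - a))).re

theorem pow_mul_conj_pow_eq_zpow {μ a : ℕ} (ha : a ≤ 2 * μ) {u : ℂ} (hu : ‖u‖ = 1) :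
    u ^ a * conj u ^ (2 * μ - a) = (u ^ 2) ^ ((a : ℤ) - μ) := by
  have hu0 : u ≠ 0 := by rw [← norm_ne_zero_iff, hu]; exact one_ne_zero
  rw [← Complex.inv_eq_conj hu, ← zpow_natCast, ← zpow_natCast, inv_zpow', ← zpow_add₀ hu0,
    ← zpow_natCast, ← zpow_mul]
  congr 1
  push_cast [Nat.cast_sub ha]
  ring

theorem exists_sq_eq_of_norm_one {η : ℂ} (hη : ‖η‖ = 1) : ∃ u : ℂ, ‖u‖ = 1 ∧ u ^ 2 = η := by
  obtain ⟨u, h⟩ := IsAlgClosed.exists_pow_nat_eq η (n := 2) (by norm_num)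
  refine ⟨u, ?_, h⟩
  have h1 : ‖u‖ ^ 2 = 1 := by rw [← norm_pow, h, hη]
  exact (pow_eq_one_iff_of_nonneg (norm_nonneg u) (by norm_num)).1 h1

theorem lineFun_unit_eq {μ : ℕ} (C : ℕ → ℂ) {u : ℂ} (hu : ‖u‖ = 1) : lineFun (2 * μ) C u =
    (∑ a ∈ Finset.range (2 * μ + 1), C a * (u ^ 2) ^ ((a : ℤ) - μ)).re := by
  unfold lineFun
  congr 1
  refine Finset.sum_congr rfl fun a ha => ?_
  rw [pow_mul_conj_pow_eq_zpow (by rw [Finset.mem_range] at ha; omega) hu]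

/-- The displacement is taken as u τ t, turning with the base point u. Each monomial then factors
into u^a ū^(2μ-a) = (u²)^(a-μ) and a second difference at 1. So for fixed t the Hessian is a
trigonometric polynomial in η = u². -/
theorem hessian_nonneg_of_midpoint {μ : ℕ} {C : ℕ → ℂ}
    (hconv : ∀ ζ t, 2 * lineFun (2 * μ) C ζ ≤
      lineFun (2 * μ) C (ζ + t) + lineFun (2 * μ) C (ζ - t))
    (t η : ℂ) (hη : ‖η‖ = 1) :
    0 ≤ (∑ a ∈ Finset.range (2 * μ + 1),
      C a * monoHessian a (2 * μ - a) t * η ^ ((a : ℤ) - μ)).re := by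
  obtain ⟨u, hu, rfl⟩ := exists_sq_eq_of_norm_one hη
  have hlim : Tendsto (fun τ : ℝ => (∑ a ∈ Finset.range (2 * μ + 1), C a *
      (((1 + τ * t) ^ a * conj (1 + τ * t) ^ (2 * μ - a)
      + (1 - τ * t) ^ a * conj (1 - τ * t) ^ (2 * μ - a) - 2) / (τ : ℂ) ^ 2) *
      (u ^ 2) ^ ((a : ℤ) - μ)).re) (𝓝[>] 0)
      (𝓝 (∑ a ∈ Finset.range (2 * μ + 1),
      C a * monoHessian a (2 * μ - a) t * (u ^ 2) ^ ((a : ℤ) - μ)).re) := by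
    refine (Complex.continuous_re.tendsto _).comp ?_
    refine tendsto_finsetSum _ fun a _ => ?_
    exact ((tendsto_second_difference_mono t a (2 * μ - a)).const_mul _).mul_const _
  refine ge_of_tendsto hlim ?_
  filter_upwards [self_mem_nhdsWithin] with τ hτ
  have hτ : 0 < τ := hτ
  have h1 := hconv u (u * (τ * t))
  have h2 : (∑ a ∈ Finset.range (2 * μ + 1), C a *
      (((1 + τ * t) ^ a * conj (1 + τ * t) ^ (2 * μ - a)
      + (1 - τ * t) ^ a * conj (1 - τ * t) ^ (2 * μ - a) - 2) / (τ : ℂ) ^ 2) *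
      (u ^ 2) ^ ((a : ℤ) - μ)).re = (lineFun (2 * μ) C (u + u * (τ * t)) +
        lineFun (2 * μ) C (u - u * (τ * t)) - 2 * lineFun (2 * μ) C u) / τ ^ 2 := by
    have hr : ∀ x : ℂ, x.re / τ ^ 2 = (x / (τ : ℂ) ^ 2).re := fun x => by
      rw [← Complex.ofReal_pow, Complex.div_ofReal_re]
    have h2' : (2 : ℝ) * lineFun (2 * μ) C u = (2 * ∑ a ∈ Finset.range (2 * μ + 1),
      C a * (u ^ a * conj u ^ (2 * μ - a))).re := by
      rw [lineFun, ← Complex.re_ofReal_mul]; simp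
    rw [h2']
    unfold lineFun
    rw [← Complex.add_re, ← Complex.sub_re, hr, ← Finset.sum_add_distrib, Finset.mul_sum,
      ← Finset.sum_sub_distrib, Finset.sum_div]
    congr 1
    refine Finset.sum_congr rfl fun a ha => ?_
    rw [← pow_mul_conj_pow_eq_zpow (by rw [Finset.mem_range] at ha; omega) hu]
    rw [show u + u * (τ * t) = u * (1 + τ * t) by ring,
      show u - u * (τ * t) = u * (1 - τ * t) by ring]
    simp only [map_mul (starRingEnd ℂ), mul_pow]
    ring
  rw [h2]
  apply div_nonneg _ (by positivity)
  linarith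

/-! ### Explicit Hessians and the coefficient bounds on a line -/

theorem monoHessian_re_im {μ l : ℕ} (hl : l ≤ μ) (x y : ℝ) :
    monoHessian (μ + l) (μ - l) (x + y * Complex.I) =
      ((2 * μ * (2 * μ - 1) * x ^ 2 + (2 * μ - (2 * l) ^ 2) * y ^ 2 : ℝ) : ℂ)
      + ((2 * (2 * l) * (2 * μ - 1) * x * y : ℝ) : ℂ) * Complex.I := by
  unfold monoHessian
  rw [map_add, map_mul, Complex.conj_I, Complex.conj_ofReal, Complex.conj_ofReal]
  push_cast [Nat.cast_sub hl]
  linear_combination ((y : ℂ) ^ 2 * ((2 * l) ^ 2 - 2 * μ)) * Complex.I_sq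

theorem monoHessian_symm (a b : ℕ) (t : ℂ) : monoHessian b a t = conj (monoHessian a b t) := by
  unfold monoHessian
  simp only [map_add, map_mul, map_sub, map_one, map_pow, map_natCast, map_ofNat, Complex.conj_conj]
  ring

theorem exists_pow_mul_eq {l : ℕ} (hl : 0 < l) (A : ℂ) {v : ℂ} (hv : ‖v‖ = 1) :
    ∃ u : ℂ, ‖u‖ = 1 ∧ A * u ^ l = ‖A‖ * v := by
  have hroot : ∀ y : ℂ, ‖y‖ = 1 → ∃ u : ℂ, ‖u‖ = 1 ∧ u ^ l = y := fun y hy => by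
    obtain ⟨u, h⟩ := IsAlgClosed.exists_pow_nat_eq y hl
    have h1 : ‖u‖ ^ l = 1 := by rw [← norm_pow, h, hy]
    exact ⟨u, (pow_eq_one_iff_of_nonneg (norm_nonneg u) hl.ne').1 h1, h⟩
  by_cases hA : A = 0
  · exact ⟨1, by simp, by simp [hA]⟩
  · have hA' : ‖A‖ ≠ 0 := norm_ne_zero_iff.2 hA
    obtain ⟨u, hu, h⟩ := hroot (‖A‖ * v / A) (by simp [hv, hA'])
    exact ⟨u, hu, by rw [h]; field_simp⟩

/-- Here s is the amplitude with which the averaging retains the frequency. Rotating by u turns the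
phase of `C (μ + l)` into an arbitrary unit vector c + ir. Division by Re `C μ` then gives the
Hessian form of r^m (1 + K cos) with K = 2s|C (μ + l)| / Re `C μ`. -/
theorem coeff_bound_of_two_frequencies {μ l : ℕ} (hl : 0 < l) (hlμ : l < μ) {C : ℕ → ℂ}
    (hsymm : C (μ - l) = conj (C (μ + l))) (h0 : 0 < (C μ).re) {s : ℝ}
    (h : ∀ t u : ℂ, ‖u‖ = 1 → 0 ≤ (C μ * monoHessian μ μ t).re
      + s * (C (μ + l) * monoHessian (μ + l) (μ - l) t * u ^ (l : ℤ)
        + C (μ - l) * monoHessian (μ - l) (μ + l) t * u ^ (-(l : ℤ))).re) :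
    2 * s * ‖C (μ + l)‖ / (C μ).re ≤ gammaKN (2 * l) (2 * μ) := by
  refine le_gammaKN_of_hessian_nonneg (by omega) (by omega) fun c r x y hcr => ?_
  obtain ⟨u, hu, hAu⟩ := exists_pow_mul_eq hl (C (μ + l)) (v := c + r * Complex.I) (by
    rw [Complex.norm_add_mul_I, hcr, Real.sqrt_one])
  have h1 := h (x + y * Complex.I) u hu
  have hconj : C (μ - l) * monoHessian (μ - l) (μ + l) (x + y * Complex.I) * u ^ (-(l : ℤ)) =
      conj (C (μ + l) * monoHessian (μ + l) (μ - l) (x + y * Complex.I) * u ^ (l : ℤ)) := by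
    rw [map_mul, map_mul, ← hsymm, ← monoHessian_symm, zpow_neg, zpow_natCast, map_pow,
      ← Complex.inv_eq_conj hu, inv_pow]
  rw [hconj, Complex.add_conj, Complex.ofReal_re, zpow_natCast, mul_right_comm, hAu] at h1
  have hμμ := monoHessian_re_im (Nat.zero_le μ) x y
  simp only [add_zero, Nat.sub_zero] at hμμ
  rw [hμμ, monoHessian_re_im hlμ.le] at h1
  simp only [Complex.add_re, Complex.mul_re, Complex.add_im, Complex.mul_im, Complex.ofReal_re,
    Complex.ofReal_im, Complex.I_re, Complex.I_im, Nat.cast_zero] at h1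
  have h2 := div_nonneg h1 h0.le
  push_cast
  refine h2.trans_eq ?_
  field_simp
  ring

/-- Averaging over roots of unity keeps the full amplitude, s = 1. -/
theorem coeff_le_gammaKN_of_lt {μ l : ℕ} (hl : 0 < l) (hlμ : l < μ) (hμ : μ < 2 * l) {C : ℕ → ℂ}
    (hsymm : C (μ - l) = conj (C (μ + l))) (h0 : 0 < (C μ).re)
    (hconv : ∀ ζ t, 2 * lineFun (2 * μ) C ζ ≤
      lineFun (2 * μ) C (ζ + t) + lineFun (2 * μ) C (ζ - t)) :
    2 * ‖C (μ + l)‖ / (C μ).re ≤ gammaKN (2 * l) (2 * μ) := by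
  have := coeff_bound_of_two_frequencies hl hlμ hsymm h0 (s := 1) fun t u hu => by
    have := re_add_add_nonneg_of_lt hl hlμ.le hμ _ (hessian_nonneg_of_midpoint hconv t) u hu
    rw [show 2 * μ - μ = μ by omega, show 2 * μ - (μ + l) = μ - l by omega,
      show 2 * μ - (μ - l) = μ + l by omega] at this
    rw [one_mul, ← Complex.add_re, ← add_assoc]
    exact this
  simpa using this

/-- The kernel 1 + cos halves the amplitude, s = 1/2, which costs the factor 2. -/
theorem coeff_le_two_mul_gammaKN {μ l : ℕ} (hl : 0 < l) (hlμ : l < μ) {C : ℕ → ℂ}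
    (hsymm : C (μ - l) = conj (C (μ + l))) (h0 : 0 < (C μ).re)
    (hconv : ∀ ζ t, 2 * lineFun (2 * μ) C ζ ≤
      lineFun (2 * μ) C (ζ + t) + lineFun (2 * μ) C (ζ - t)) :
    2 * ‖C (μ + l)‖ / (C μ).re ≤ 2 * gammaKN (2 * l) (2 * μ) := by
  have := coeff_bound_of_two_frequencies hl hlμ hsymm h0 (s := 1 / 2) fun t u hu => by
    have := two_re_add_add_nonneg hl hlμ.le _ (hessian_nonneg_of_midpoint hconv t) u hu
    rw [show 2 * μ - μ = μ by omega, show 2 * μ - (μ + l) = μ - l by omega,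
      show 2 * μ - (μ - l) = μ + l by omega, Complex.add_re, Complex.add_re] at this
    rw [Complex.add_re]
    have h2 : (2 * (C μ * monoHessian μ μ t)).re = 2 * (C μ * monoHessian μ μ t).re := by simp
    linarith
  rw [div_le_iff₀ h0] at this ⊢
  linarith

theorem lineFun_unit_nonneg_zero_frequency {μ : ℕ} (hμ : 0 < μ) {C : ℕ → ℂ}
    (h : ∀ ζ, 0 ≤ lineFun (2 * μ) C ζ) : 0 ≤ (C μ).re := by
  refine re_zero_frequency_nonneg hμ C fun η hη => ?_
  obtain ⟨u, hu, rfl⟩ := exists_sq_eq_of_norm_one hη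
  rw [← lineFun_unit_eq C hu]
  exact h u

/-! ### Homogeneous polynomials on lines -/

theorem isHomogeneous_of_constant_weight {n m : ℕ} (hm : 0 < m) {P : ZPoly n}
    (hP : MvPolynomial.IsWeightedHomogeneous (zWeight fun _ => 1 / (m : ℝ)) P 1) :
    P.IsHomogeneous m := by
  intro d hd
  have h := hP hd
  have hw : zWeight (fun _ : Fin n => 1 / (m : ℝ)) = fun _ => 1 / (m : ℝ) := by
    funext i; cases i <;> rfl
  have hm' : (m : ℝ) ≠ 0 := by exact_mod_cast hm.ne'
  rw [hw, Finsupp.weight_apply, Finsupp.sum] at h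
  rw [Finsupp.weight_apply, Finsupp.sum]
  simp only [nsmul_eq_mul, ← Finset.sum_mul] at h
  simp only [Pi.one_apply, smul_eq_mul, mul_one]
  field_simp at h
  exact_mod_cast h

theorem ZPoly.val_smul {n m : ℕ} {P : ZPoly n} (hP : P.IsHomogeneous m) (r : ℝ)
    (z : Fin n → ℂ) : P.val ((r : ℂ) • z) = (r : ℂ) ^ m * P.val z := by
  unfold ZPoly.val
  have harg : (Sum.elim ((r : ℂ) • z) fun j => conj (((r : ℂ) • z) j)) =
      (r : ℂ) • (Sum.elim z fun j => conj (z j) : Fin n ⊕ Fin n → ℂ) := by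
    funext i
    cases i <;> simp
  rw [harg, MvPolynomial.eval_eq, MvPolynomial.eval_eq, Finset.mul_sum]
  refine Finset.sum_congr rfl fun d hd => ?_
  have hdeg : ∑ i ∈ d.support, d i = m := hP.degree_eq_sum_deg_support hd |>.symm
  simp only [Pi.smul_apply, smul_eq_mul, mul_pow, Finset.prod_mul_distrib]
  rw [Finset.prod_pow_eq_pow_sum, hdeg]
  ring

theorem ZPoly.continuous_val {n : ℕ} (P : ZPoly n) : Continuous P.val := by
  refine (MvPolynomial.continuous_eval P).comp (continuous_pi fun i => ?_)
  cases i
  · exact continuous_apply _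
  · exact Complex.continuous_conj.comp (continuous_apply _)

theorem ZPoly.val_smul_eq_sum_lineCoeff {n m : ℕ} {P : ZPoly n} (hP : P.IsHomogeneous m)
    (c : Fin n → ℂ) (ζ : ℂ) : P.val (ζ • c) =
      ∑ a ∈ Finset.range (m + 1), P.lineCoeff c a (m - a) * (ζ ^ a * conj ζ ^ (m - a)) := by
  have hhom : (P.restrict c).IsHomogeneous m := by
    have := hP.aeval (n := 1) (Sum.elim (fun j => MvPolynomial.C (c j) * MvPolynomial.X 0)
      fun j => MvPolynomial.C (conj (c j)) * MvPolynomial.X 1 : Fin n ⊕ Fin n →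
        MvPolynomial (Fin 2) ℂ) (by
      rintro (j | j)
      · exact MvPolynomial.isHomogeneous_C_mul_X _ _
      · exact MvPolynomial.isHomogeneous_C_mul_X _ _)
    rwa [one_mul] at this
  have hval : P.val (ζ • c) = MvPolynomial.eval ![ζ, conj ζ] (P.restrict c) := by
    unfold ZPoly.val ZPoly.restrict
    rw [MvPolynomial.map_aeval, MvPolynomial.eval]
    congr 2
    · ext x
      simp
    · funext i
      cases i <;> simp [mul_comm]
  rw [hval, MvPolynomial.eval_eq']
  have hinj : Set.InjOn (fun a : ℕ => (Finsupp.single 0 a + Finsupp.single 1 (m - a) : Fin 2 →₀ ℕ))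
      (Finset.range (m + 1)) := fun a _ b _ h => by
    simpa using DFunLike.congr_fun h 0
  have hsub : (P.restrict c).support ⊆ (Finset.range (m + 1)).image
      (fun a : ℕ => (Finsupp.single 0 a + Finsupp.single 1 (m - a) : Fin 2 →₀ ℕ)) := by
    intro d hd
    have hdeg : d 0 + d 1 = m := by
      have := hhom (MvPolynomial.mem_support_iff.1 hd)
      rw [Finsupp.weight_apply, Finsupp.sum_fintype _ _ (by simp)] at this
      simpa [Fin.sum_univ_two] using this
    refine Finset.mem_image.2 ⟨d 0, Finset.mem_range.2 (by omega), ?_⟩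
    ext i
    fin_cases i
    · simp
    · simp; omega
  rw [Finset.sum_subset hsub, Finset.sum_image hinj]
  · refine Finset.sum_congr rfl fun a _ => ?_
    simp [Fin.prod_univ_two, ZPoly.lineCoeff]
  · intro d _ hd
    rw [MvPolynomial.notMem_support_iff.1 hd, zero_mul]

/-! ### Conjugate symmetry of the coefficients on a line -/

theorem eq_zero_of_sum_mul_pow_eq_zero {N : ℕ} {d : ℕ → ℂ}
    (h : ∀ η : ℂ, ‖η‖ = 1 → ∑ a ∈ Finset.range N, d a * η ^ a = 0) {a : ℕ} (ha : a < N) :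
    d a = 0 := by
  set p : Polynomial ℂ := ∑ a ∈ Finset.range N, Polynomial.monomial a (d a) with hp
  have hinf : Set.Infinite {η : ℂ | ‖η‖ = 1} := by
    have := (isPreconnected_sphere (E := ℂ) (by simp) 0 1).infinite_of_nontrivial
      ⟨1, by simp, -1, by simp, by norm_num⟩
    refine this.mono fun x hx => by simpa using hx
  have hp0 : p = 0 := Polynomial.eq_zero_of_infinite_isRoot p (hinf.mono fun η hη => by
    simp only [Set.mem_ofPred_eq, Polynomial.IsRoot.def, hp, Polynomial.eval_finsetSum,
      Polynomial.eval_monomial]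
    exact h η hη)
  have : p.coeff a = d a := by
    rw [hp, Polynomial.finsetSum_coeff]
    simp only [Polynomial.coeff_monomial]
    rw [Finset.sum_ite_eq', if_pos (Finset.mem_range.2 ha)]
  rw [← this, hp0, Polynomial.coeff_zero]

/-- Reality of P on the unit circle, multiplied by ū^m, becomes a polynomial identity in ū². A
polynomial vanishing on the circle has zero coefficients. -/
theorem ZPoly.lineCoeff_conj {n m : ℕ} {P : ZPoly n} (hP : P.IsHomogeneous m) (hreal : P.IsReal)
    (c : Fin n → ℂ) {a : ℕ} (ha : a ≤ m) :
    P.lineCoeff c (m - a) a = conj (P.lineCoeff c a (m - a)) := by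
  set C : ℕ → ℂ := fun a => P.lineCoeff c a (m - a) with hC
  have hsum : ∀ u : ℂ, ‖u‖ = 1 →
      ∑ a ∈ Finset.range (m + 1), (C (m - a) - conj (C a)) * (conj u ^ 2) ^ a = 0 := by
    intro u hu
    have h1 : conj (P.val (u • c)) = P.val (u • c) := Complex.conj_eq_iff_im.2 (hreal _)
    rw [ZPoly.val_smul_eq_sum_lineCoeff hP, map_sum] at h1
    have h2 := h1.symm
    rw [← Finset.sum_range_reflect, ← sub_eq_zero, ← Finset.sum_sub_distrib] at h2
    have hu0 : u * conj u = 1 := by rw [Complex.mul_conj, Complex.normSq_eq_norm_sq, hu]; simp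
    have h3 : conj u ^ m * ∑ a ∈ Finset.range (m + 1),
        (C (m - a) - conj (C a)) * (u ^ (m - a) * conj u ^ a) = 0 := by
      rw [← mul_zero (conj u ^ m)]
      congr 1
      rw [← h2]
      refine Finset.sum_congr rfl fun a ha => ?_
      have ha : a ≤ m := by rw [Finset.mem_range] at ha; omega
      rw [show m + 1 - 1 - a = m - a by omega, show m - (m - a) = a by omega]
      simp only [hC, map_mul, map_pow, Complex.conj_conj]
      rw [show m - (m - a) = a by omega]
      ring
    rw [← h3, Finset.mul_sum]
    refine Finset.sum_congr rfl fun a ha => ?_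
    have ha : a ≤ m := by rw [Finset.mem_range] at ha; omega
    obtain ⟨b, rfl⟩ := Nat.exists_eq_add_of_le ha
    rw [show a + b - a = b by omega]
    have h4 : u ^ b * conj u ^ b = 1 := by rw [← mul_pow, hu0, one_pow]
    linear_combination (-(C b - conj (C a)) * conj u ^ a * conj u ^ a) * h4
  have h0 := eq_zero_of_sum_mul_pow_eq_zero (N := m + 1)
    (d := fun a => C (m - a) - conj (C a)) (fun η hη => by
      obtain ⟨u, hu, rfl⟩ := exists_sq_eq_of_norm_one hη
      have := hsum (conj u) (by simpa using hu)
      simpa using this) (Nat.lt_succ_of_le ha)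
  have h1 := sub_eq_zero.1 h0
  simpa only [hC, show m - (m - a) = a by omega] using h1

/-! ### Anisotropic scaling -/

/-- A monomial of weight > 1 scales with an integer power of ε exceeding m, so a positive power
remains after division by ε^m. The arguments may vary with ε because the scaled midpoints are known
only in the limit. -/
theorem tendsto_ZUPoly_val_scaled {n m : ℕ} (hm : 0 < m) {R : ZUPoly n}
    (hR : ∀ d ∈ R.support, 1 < Finsupp.weight (zuWeight fun _ => 1 / (m : ℝ)) d)
    {y : ℝ → Fin n → ℂ} {y₀ : Fin n → ℂ} {ν : ℝ → ℝ} {ν₀ : ℝ}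
    (hy : Tendsto y (𝓝[>] 0) (𝓝 y₀)) (hν : Tendsto ν (𝓝[>] 0) (𝓝 ν₀)) :
    Tendsto (fun ε : ℝ => R.val ((ε : ℂ) • y ε, ε ^ m * ν ε) / (ε : ℂ) ^ m) (𝓝[>] 0) (𝓝 0) := by
  have hε : Tendsto (fun ε : ℝ => (ε : ℂ)) (𝓝[>] 0) (𝓝 0) :=
    (Complex.continuous_ofReal.tendsto' 0 0 rfl).mono_left nhdsWithin_le_nhds
  let k : (Fin n ⊕ Fin n) ⊕ Unit → ℕ := Sum.elim (fun _ => 1) fun _ => m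
  let X : ℝ → (Fin n ⊕ Fin n) ⊕ Unit → ℂ := fun ε =>
    Sum.elim (Sum.elim (y ε) fun j => conj (y ε j)) fun _ => (ν ε : ℂ)
  let X₀ : (Fin n ⊕ Fin n) ⊕ Unit → ℂ :=
    Sum.elim (Sum.elim y₀ fun j => conj (y₀ j)) fun _ => (ν₀ : ℂ)
  have hX : ∀ i, Tendsto (fun ε => X ε i) (𝓝[>] 0) (𝓝 (X₀ i)) := by
    rintro ((j | j) | _)
    · exact tendsto_pi_nhds.1 hy j
    · exact (Complex.continuous_conj.tendsto _).comp (tendsto_pi_nhds.1 hy j)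
    · exact (Complex.continuous_ofReal.tendsto _).comp hν
  have hlt : ∀ d ∈ R.support, m < ∑ i, k i * d i := by
    intro d hd
    have h1 := hR d hd
    rw [Finsupp.weight_apply, Finsupp.sum_fintype _ _ (by simp)] at h1
    have h2 : ∀ i, d i • zuWeight (fun _ : Fin n => 1 / (m : ℝ)) i = (k i * d i : ℕ) / (m : ℝ) := by
      have hm' : (m : ℝ) ≠ 0 := by exact_mod_cast hm.ne'
      rintro ((j | j) | _)
      · simp [zuWeight, zWeight, k, div_eq_mul_inv]
      · simp [zuWeight, zWeight, k, div_eq_mul_inv]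
      · simp [zuWeight, k, field]
    simp_rw [h2] at h1
    rw [← Finset.sum_div, one_lt_div (by exact_mod_cast hm)] at h1
    exact_mod_cast h1
  have hterm : ∀ d ∈ R.support, Tendsto (fun ε : ℝ =>
      R.coeff d * ((∏ i, X ε i ^ d i) * (ε : ℂ) ^ (∑ i, k i * d i - m))) (𝓝[>] 0) (𝓝 0) := by
    intro d hd
    have hlt := hlt d hd
    have h0 : Tendsto (fun ε : ℝ => (ε : ℂ) ^ (∑ i, k i * d i - m)) (𝓝[>] 0) (𝓝 0) := by
      have := hε.pow (∑ i, k i * d i - m)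
      rwa [zero_pow (by omega)] at this
    have := ((tendsto_finsetProd Finset.univ fun i _ => (hX i).pow (d i)).mul h0).const_mul
      (R.coeff d)
    simpa using this
  have hsum := tendsto_finsetSum R.support hterm
  rw [Finset.sum_const_zero] at hsum
  refine hsum.congr' ?_
  filter_upwards [self_mem_nhdsWithin] with ε hε
  have hε0 : (ε : ℂ) ≠ 0 := by exact_mod_cast (ne_of_gt hε)
  unfold ZUPoly.val
  rw [MvPolynomial.eval_eq', Finset.sum_div]
  refine Finset.sum_congr rfl fun d hd => ?_
  have harg : ∀ i, (Sum.elim (Sum.elim ((ε : ℂ) • y ε) fun j => conj (((ε : ℂ) • y ε) j))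
      fun _ => ((ε ^ m * ν ε : ℝ) : ℂ) : (Fin n ⊕ Fin n) ⊕ Unit → ℂ) i =
      (ε : ℂ) ^ k i * X ε i := by
    rintro ((j | j) | _) <;> simp [k, X]
  simp_rw [harg, mul_pow, ← pow_mul]
  rw [Finset.prod_mul_distrib, Finset.prod_pow_eq_pow_sum, pow_sub₀ _ hε0 (hlt d hd).le]
  ring

/-- The graphing function under the scaling `z ↦ ε z`, `u ↦ ε ^ m u`. -/
theorem tendsto_graph_scaled {n m : ℕ} (hm : 0 < m) {Ψ : (Fin n → ℂ) × ℝ → ℝ} {P : ZPoly n}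
    (hP : P.IsHomogeneous m) (hΨ : IsLeadingPart (fun _ => 1 / (m : ℝ)) Ψ P)
    {y : ℝ → Fin n → ℂ} {y₀ : Fin n → ℂ} {ν : ℝ → ℝ} {ν₀ : ℝ}
    (hy : Tendsto y (𝓝[>] 0) (𝓝 y₀)) (hν : Tendsto ν (𝓝[>] 0) (𝓝 ν₀)) :
    Tendsto (fun ε : ℝ => Ψ ((ε : ℂ) • y ε, ε ^ m * ν ε) / ε ^ m) (𝓝[>] 0)
      (𝓝 (P.val y₀).re) := by
  -- Order m suffices: the scaled points have norm O(ε), so the Taylor remainder is o(ε^m).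
  obtain ⟨R, hR, ho⟩ := hΨ m
  have hε : Tendsto (fun ε : ℝ => ε) (𝓝[>] 0) (𝓝 0) := nhdsWithin_le_nhds
  have hεc : Tendsto (fun ε : ℝ => (ε : ℂ)) (𝓝[>] 0) (𝓝 0) :=
    (Complex.continuous_ofReal.tendsto' 0 0 rfl).mono_left nhdsWithin_le_nhds
  have hx : Tendsto (fun ε : ℝ => (((ε : ℂ) • y ε, ε ^ m * ν ε) : (Fin n → ℂ) × ℝ)) (𝓝[>] 0)
      (𝓝 0) := by
    have h1 := (hεc.smul hy).prodMk_nhds ((hε.pow m).mul hν)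
    rw [zero_smul, zero_pow hm.ne', zero_mul] at h1
    exact h1
  have hO : (fun ε : ℝ => (((ε : ℂ) • y ε, ε ^ m * ν ε) : (Fin n → ℂ) × ℝ)) =O[𝓝[>] 0]
      fun ε : ℝ => ε := by
    refine IsBigO.prod_left ?_ ?_
    · have h1 : (fun ε : ℝ => (ε : ℂ)) =O[𝓝[>] 0] fun ε : ℝ => ε :=
        IsBigO.of_bound 1 (Eventually.of_forall fun ε => by simp)
      simpa using h1.smul (hy.isBigO_one ℝ)
    · have h1 : (fun ε : ℝ => ε ^ m) =O[𝓝[>] 0] fun ε : ℝ => ε := by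
        have := (isBigO_refl (fun ε : ℝ => ε) (𝓝[>] 0)).mul ((hε.pow (m - 1)).isBigO_one ℝ)
        simpa [← pow_succ', Nat.sub_add_cancel hm] using this
      simpa using h1.mul (hν.isBigO_one ℝ)
  have ho' := (ho.comp_tendsto hx).trans_isBigO (hO.norm_left.pow m)
  have hO2 : (fun ε : ℝ => ε ^ m) =O[𝓝[>] 0] fun ε : ℝ => (ε : ℂ) ^ m :=
    IsBigO.of_bound 1 (Eventually.of_forall fun ε => by simp)
  have h1 := (ho'.trans_isBigO hO2).tendsto_div_nhds_zero
  have h2 := tendsto_ZUPoly_val_scaled hm hR hy hν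
  have h3 := (P.continuous_val.tendsto y₀).comp hy
  have h4 := (Complex.continuous_re.tendsto _).comp ((h1.add h2).add h3)
  rw [add_zero, zero_add] at h4
  refine h4.congr' ?_
  filter_upwards [self_mem_nhdsWithin] with ε hε
  have hε0 : (ε : ℂ) ^ m ≠ 0 := pow_ne_zero _ (by exact_mod_cast (ne_of_gt hε))
  have h5 : P.val (y ε) = P.val ((ε : ℂ) • y ε) / (ε : ℂ) ^ m := by
    rw [ZPoly.val_smul hP, mul_div_cancel_left₀ _ hε0]
  simp only [Function.comp_apply]
  rw [h5, ← add_div, ← add_div, sub_add_cancel, sub_add_cancel, ← Complex.ofReal_pow,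
    ← Complex.ofReal_div, Complex.ofReal_re]

/-! ### Holomorphic functions of several variables near the origin -/

section Holomorphic

variable {E F : Type*} [NormedAddCommGroup E] [NormedSpace ℂ E]
  [NormedAddCommGroup F] [NormedSpace ℂ F]

/-- A map that is complex differentiable near a point is strictly differentiable there. -/
theorem hasStrictFDerivAt_of_eventually_differentiableAt {f : E → F}
    (hf : ∀ᶠ z in 𝓝 (0 : E), DifferentiableAt ℂ f z) :
    HasStrictFDerivAt f (fderiv ℂ f 0) 0 := by
  let _ : NormedSpace ℝ E := NormedSpace.restrictScalars ℝ ℂ E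
  refine HasStrictFDerivAt.of_isLittleO (isLittleO_iff.2 fun c hc => ?_)
  let K : E → F := fun z => f z - f 0 - fderiv ℂ f 0 z
  have hsmall : ∀ᶠ z in 𝓝 (0 : E), ‖K z‖ ≤ c / 4 * ‖z‖ := by
    have h := (hf.self_of_nhds.hasFDerivAt.isLittleO).def (show 0 < c / 4 by positivity)
    filter_upwards [h] with z hz
    simpa [K] using hz
  obtain ⟨r, hr, hball⟩ := Metric.eventually_nhds_iff_ball.1 (hf.and hsmall)
  have hK : ∀ z ∈ Metric.ball (0 : E) r, DifferentiableAt ℂ K z := fun z hz =>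
    ((hball z hz).1.sub_const _).sub (fderiv ℂ f 0).differentiableAt
  have hsub : ∀ z ∈ Metric.ball (0 : E) (r / 2), Metric.ball z (r / 2) ⊆ Metric.ball 0 r := by
    intro z hz
    refine Metric.ball_subset_ball' ?_
    rw [Metric.mem_ball] at hz
    linarith
  have hbound : ∀ z ∈ Metric.ball (0 : E) r, ‖K z‖ ≤ c / 4 * r := fun z hz => by
    refine (hball z hz).2.trans ?_
    gcongr
    exact (mem_ball_zero_iff.1 hz).le
  -- A Schwarz estimate on balls of radius r/2: `K` oscillates by at most 2 · (c/4) r there, so its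
  -- derivative is at most c. The mean value inequality then gives strictness.
  have hderiv : ∀ z ∈ Metric.ball (0 : E) (r / 2), ‖fderiv ℂ K z‖ ≤ c := by
    intro z hz
    have h := Complex.norm_fderiv_le_div_of_mapsTo_ball (f := K) (c := z) (R₁ := r / 2)
      (R₂ := c / 2 * r) (fun q hq => (hK q (hsub z hz hq)).differentiableWithinAt)
      (fun q hq => by
        rw [mem_closedBall_iff_norm]
        refine (norm_sub_le _ _).trans ?_
        have h1 := hbound q (hsub z hz hq)
        have h2 := hbound z (hsub z hz (Metric.mem_ball_self (by positivity)))
        linarith) (by positivity)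
    refine h.trans_eq ?_
    field_simp
  have hmem : Metric.ball (0 : E) (r / 2) ∈ 𝓝 (0 : E) := Metric.ball_mem_nhds _ (by positivity)
  filter_upwards [prod_mem_nhds hmem hmem] with p hp
  have h := Convex.norm_image_sub_le_of_norm_fderiv_le (𝕜 := ℂ) (f := K)
    (fun z hz => hK z (Metric.ball_subset_ball (by linarith) hz)) hderiv
    (convex_ball (0 : E) (r / 2)) hp.2 hp.1
  have h2 : K p.1 - K p.2 = f p.1 - f p.2 - fderiv ℂ f 0 (p.1 - p.2) := by
    simp only [K, map_sub]; abel
  rwa [h2] at h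

/-- If `f` has the leading term `b y ζ ^ m` on each line through the origin, then the blow-ups
`f (ε y) / ε ^ m` converge locally uniformly. -/
theorem tendsto_blowup_of_lines {f : E → ℂ} (hf : ∀ᶠ z in 𝓝 (0 : E), DifferentiableAt ℂ f z)
    {m : ℕ} (hm : 0 < m) {b : E → ℂ}
    (hb : ∀ y : E, (fun ζ : ℂ => f (ζ • y) - b y * ζ ^ m) =o[𝓝 0] fun ζ => ζ ^ m)
    {y : ℝ → E} {y₀ : E} (hy : Tendsto y (𝓝[>] 0) (𝓝 y₀)) :
    Tendsto (fun ε : ℝ => f ((ε : ℂ) • y ε) / (ε : ℂ) ^ m) (𝓝[>] 0) (𝓝 (b y₀)) := by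
  have hf0 : f 0 = 0 := by
    have h := (hb 0).isBigO.eq_zero_imp.self_of_nhds
    simpa [zero_pow hm.ne'] using h
  have hbdd : ∀ᶠ z in 𝓝 (0 : E), ‖f z‖ ≤ 1 := by
    have := hf.self_of_nhds.continuousAt.norm
    rw [ContinuousAt, hf0, norm_zero] at this
    exact this.eventually (Iic_mem_nhds one_pos)
  obtain ⟨r, hr, hball⟩ := Metric.eventually_nhds_iff_ball.1 (hf.and hbdd)
  -- The Schwarz lemma of order m, applied on each complex line, makes the vanishing order uniform
  -- in the direction.
  have hgrowth : ∀ z ∈ Metric.ball (0 : E) r, ‖f z‖ ≤ (‖z‖ / r) ^ m := by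
    intro z hz
    rcases eq_or_ne z 0 with rfl | hz0
    · simp [hf0, zero_pow hm.ne']
    have hz' : 0 < ‖z‖ := norm_pos_iff.2 hz0
    have hmaps : ∀ ζ ∈ Metric.ball (0 : ℂ) (r / ‖z‖), ζ • z ∈ Metric.ball (0 : E) r := by
      intro ζ hζ
      rw [mem_ball_zero_iff, lt_div_iff₀ hz'] at hζ
      rwa [mem_ball_zero_iff, norm_smul]
    have ho : (fun ζ : ℂ => f (ζ • z)) =o[𝓝 0] fun ζ : ℂ => ‖ζ‖ ^ (m - 1) := by
      have h1 : (fun ζ : ℂ => f (ζ • z)) =O[𝓝 0] fun ζ : ℂ => ζ ^ m := by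
        have := (hb z).isBigO.add (isBigO_const_mul_self (b z) (fun ζ : ℂ => ζ ^ m) (𝓝 0))
        simpa using this
      have h2 := h1.trans_isLittleO (isLittleO_pow_pow (𝕜 := ℂ) (show m - 1 < m by omega))
      simpa using h2.norm_right
    have h := Complex.dist_le_mul_div_pow_of_mapsTo_ball_of_isLittleO (f := fun ζ : ℂ => f (ζ • z))
      (c := 0) (z := 1) (R₁ := r / ‖z‖) (R₂ := 1) (n := m - 1)
      (fun ζ hζ => (DifferentiableAt.comp ζ (hball _ (hmaps ζ hζ)).1
        (by fun_prop : DifferentiableAt ℂ (fun ζ : ℂ => ζ • z) ζ)).differentiableWithinAt)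
      (fun ζ hζ => by
        simpa [hf0] using (hball _ (hmaps ζ hζ)).2)
      (by simpa [hf0] using ho)
      (by rw [mem_ball_zero_iff, norm_one, one_lt_div hz']; exact mem_ball_zero_iff.1 hz)
    rw [Nat.sub_add_cancel hm] at h
    simpa [hf0] using h
  have hε : Tendsto (fun ε : ℝ => ε) (𝓝[>] 0) (𝓝 0) := nhdsWithin_le_nhds
  have hεc : Tendsto (fun ε : ℝ => (ε : ℂ)) (𝓝[>] 0) (𝓝 0) :=
    (Complex.continuous_ofReal.tendsto' 0 0 rfl).mono_left nhdsWithin_le_nhds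
  have hline : Tendsto (fun ε : ℝ => f ((ε : ℂ) • y₀) / (ε : ℂ) ^ m) (𝓝[>] 0) (𝓝 (b y₀)) := by
    have h := (((hb y₀).comp_tendsto hεc).tendsto_div_nhds_zero).add_const (b y₀)
    rw [zero_add] at h
    refine h.congr' ?_
    filter_upwards [self_mem_nhdsWithin] with ε hε
    have hε0 : (ε : ℂ) ≠ 0 := by exact_mod_cast (ne_of_gt hε)
    simp only [Function.comp_apply]
    field_simp
    ring
  set B : ℝ := 2 * ((‖y₀‖ + 1) / r) ^ m with hB
  -- By `hgrowth`, f oscillates by at most B ε^m on the ball of radius ε about ε y₀. The Schwarz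
  -- lemma then gives a Lipschitz bound for the rescaled f, so replacing y₀ by y ε costs nothing in
  -- the limit.
  have hdiff : Tendsto (fun ε : ℝ => (f ((ε : ℂ) • y ε) - f ((ε : ℂ) • y₀)) / (ε : ℂ) ^ m)
      (𝓝[>] 0) (𝓝 0) := by
    have hlim : Tendsto (fun ε : ℝ => B * ‖y ε - y₀‖) (𝓝[>] 0) (𝓝 0) := by
      have := ((hy.sub_const y₀).norm).const_mul B
      simpa using this
    refine squeeze_zero_norm' ?_ hlim
    have hε1 : ∀ᶠ ε : ℝ in 𝓝[>] 0, ε * (‖y₀‖ + 1) < r := by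
      have : Tendsto (fun ε : ℝ => ε * (‖y₀‖ + 1)) (𝓝[>] 0) (𝓝 0) := by
        simpa using hε.mul_const (‖y₀‖ + 1)
      exact this.eventually (Iio_mem_nhds hr)
    filter_upwards [self_mem_nhdsWithin, hε1, hy.eventually (Metric.ball_mem_nhds y₀ one_pos)]
      with ε hε hεr hyε
    have hε : 0 < ε := hε
    have hεn : ‖(ε : ℂ)‖ = ε := by simp [hε.le]
    have hsub : ∀ q ∈ Metric.ball ((ε : ℂ) • y₀) ε, ‖q‖ ≤ ε * (‖y₀‖ + 1) := by
      intro q hq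
      rw [mem_ball_iff_norm] at hq
      have h1 := norm_add_le (q - (ε : ℂ) • y₀) ((ε : ℂ) • y₀)
      rw [sub_add_cancel, norm_smul, hεn] at h1
      linarith
    have hfq : ∀ q ∈ Metric.ball ((ε : ℂ) • y₀) ε, ‖f q‖ ≤ B / 2 * ε ^ m := by
      intro q hq
      have h1 := hsub q hq
      refine (hgrowth q (mem_ball_zero_iff.2 (h1.trans_lt hεr))).trans ?_
      calc (‖q‖ / r) ^ m ≤ (ε * (‖y₀‖ + 1) / r) ^ m := by gcongr
        _ = B / 2 * ε ^ m := by rw [hB, mul_div_assoc, mul_pow]; ring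
    have h := Complex.dist_le_div_mul_dist_of_mapsTo_ball (f := f) (c := (ε : ℂ) • y₀)
      (z := (ε : ℂ) • y ε) (R₁ := ε) (R₂ := B * ε ^ m)
      (fun q hq => (hball q (mem_ball_zero_iff.2
        ((hsub q hq).trans_lt hεr))).1.differentiableWithinAt)
      (fun q hq => by
        rw [mem_closedBall_iff_norm]
        refine (norm_sub_le _ _).trans ?_
        have h1 := hfq q hq
        have h2 := hfq _ (Metric.mem_ball_self hε)
        linarith)
      (by
        rw [mem_ball_iff_norm, ← smul_sub, norm_smul, hεn]
        rw [dist_eq_norm] at hyε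
        nlinarith)
    rw [dist_eq_norm, dist_eq_norm, ← smul_sub, norm_smul, hεn] at h
    rw [norm_div, norm_pow, hεn, div_le_iff₀ (by positivity)]
    refine h.trans_eq ?_
    field_simp
  have := hline.add hdiff
  rw [add_zero] at this
  refine this.congr fun ε => ?_
  rw [← add_div]
  congr 1
  ring

end Holomorphic

/-- A holomorphic germ on `ℂ` vanishes to order `m` if its imaginary part is bounded below by
`-C |ζ| ^ m` on each ray. -/
theorem exists_leading_coeff_of_im_lower_bound {g : ℂ → ℂ} (hg : AnalyticAt ℂ g 0) (h0 : g 0 = 0)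
    {m : ℕ} (hlow : ∀ v : ℂ, ∃ B : ℝ, ∀ᶠ ε : ℝ in 𝓝[>] 0, -(B * ε ^ m) ≤ (g (ε * v)).im) :
    ∃ b : ℂ, (fun ζ : ℂ => g ζ - b * ζ ^ m) =o[𝓝 0] fun ζ => ζ ^ m := by
  by_cases hz : ∀ᶠ z in 𝓝 (0 : ℂ), g z = 0
  · refine ⟨0, ?_⟩
    refine (isLittleO_zero _ _).congr' ?_ EventuallyEq.rfl
    filter_upwards [hz] with z hz
    simp [hz]
  obtain ⟨k, g₁, hg₁, hg₁0, heq⟩ := hg.exists_eventuallyEq_pow_smul_nonzero_iff.2 hz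
  simp only [sub_zero, smul_eq_mul] at heq
  have hk : 0 < k := by
    rcases Nat.eq_zero_or_pos k with rfl | hk
    · have := heq.self_of_nhds
      simp [h0] at this
      exact absurd this.symm hg₁0
    · exact hk
  have hmk : m ≤ k := by
    by_contra! hkm
    -- If the order k were < m, this ray would make the leading term a negative multiple of i, of
    -- size ε^k, violating the lower bound of size ε^m.
    obtain ⟨v, -, hv⟩ := exists_pow_mul_eq hk (g₁ 0) (v := -Complex.I) (by simp)
    obtain ⟨B, hB⟩ := hlow v
    have hεv : Tendsto (fun ε : ℝ => (ε : ℂ) * v) (𝓝[>] 0) (𝓝 0) := by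
      have : Continuous fun ε : ℝ => (ε : ℂ) * v := by fun_prop
      exact (this.tendsto' 0 0 (by simp)).mono_left nhdsWithin_le_nhds
    have hlim1 : Tendsto (fun ε : ℝ => (v ^ k * g₁ (ε * v)).im) (𝓝[>] 0)
        (𝓝 (v ^ k * g₁ 0).im) :=
      (Complex.continuous_im.tendsto _).comp
        ((hg₁.continuousAt.tendsto.comp hεv).const_mul (v ^ k))
    have hlim2 : Tendsto (fun ε : ℝ => -(B * ε ^ (m - k))) (𝓝[>] 0) (𝓝 0) := by
      have : Continuous fun ε : ℝ => -(B * ε ^ (m - k)) := by fun_prop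
      exact (this.tendsto' 0 0 (by simp [zero_pow (show m - k ≠ 0 by omega)])).mono_left
        nhdsWithin_le_nhds
    have hle : (0 : ℝ) ≤ (v ^ k * g₁ 0).im := by
      refine le_of_tendsto_of_tendsto hlim2 hlim1 ?_
      filter_upwards [self_mem_nhdsWithin, hB, hεv.eventually heq] with ε hε hBε hgε
      have hε : 0 < ε := hε
      rw [hgε, mul_pow, mul_assoc, ← Complex.ofReal_pow, Complex.im_ofReal_mul] at hBε
      have h3 : ε ^ m = ε ^ k * ε ^ (m - k) := by rw [← pow_add]; congr 1; omega
      rw [h3] at hBε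
      have : ε ^ k * -(B * ε ^ (m - k)) ≤ ε ^ k * (v ^ k * g₁ (ε * v)).im := by linarith
      exact le_of_mul_le_mul_left this (by positivity)
    rw [mul_comm, hv] at hle
    simp at hle
    exact hg₁0 hle
  -- The factor is 1 if k = m and 0 if k > m.
  refine ⟨(0 : ℂ) ^ (k - m) * g₁ 0, ?_⟩
  have hc : Tendsto (fun ζ : ℂ => ζ ^ (k - m) * g₁ ζ - (0 : ℂ) ^ (k - m) * g₁ 0) (𝓝 0) (𝓝 0) := by
    have h1 : ContinuousAt (fun ζ : ℂ => ζ ^ (k - m) * g₁ ζ) 0 :=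
      (continuousAt_id.pow _).mul hg₁.continuousAt
    simpa using h1.tendsto.sub_const ((0 : ℂ) ^ (k - m) * g₁ 0)
  have ho := ((isLittleO_one_iff ℂ).2 hc).mul_isBigO (isBigO_refl (fun ζ : ℂ => ζ ^ m) (𝓝 0))
  simp only [one_mul] at ho
  refine ho.congr' ?_ EventuallyEq.rfl
  filter_upwards [heq] with ζ hζ
  rw [hζ, sub_mul, mul_right_comm, ← pow_add, Nat.sub_add_cancel hmk]

/-! ### Holomorphic support functions of a hypersurface -/

theorem tendsto_ofReal_nhdsGT_zero : Tendsto (fun ε : ℝ => (ε : ℂ)) (𝓝[>] 0) (𝓝 0) :=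
  (Complex.continuous_ofReal.tendsto' 0 0 rfl).mono_left nhdsWithin_le_nhds

theorem tendsto_smul_pow_mul_zero {n m : ℕ} (hm : 0 < m) {y : ℝ → Fin n → ℂ} {y₀ : Fin n → ℂ}
    {w : ℝ → ℂ} {w₀ : ℂ} (hy : Tendsto y (𝓝[>] 0) (𝓝 y₀)) (hw : Tendsto w (𝓝[>] 0) (𝓝 w₀)) :
    Tendsto (fun ε : ℝ => (((ε : ℂ) • y ε, (ε : ℂ) ^ m * w ε) : CSpace n)) (𝓝[>] 0) (𝓝 0) := by
  have h := (tendsto_ofReal_nhdsGT_zero.smul hy).prodMk_nhds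
    ((tendsto_ofReal_nhdsGT_zero.pow m).mul hw)
  rw [zero_smul, zero_pow hm.ne', zero_mul] at h
  exact h

/-- Division by w of the increment from (z, 0) to (z, w). Strict differentiability compares these
two moving points and yields the limit of β; on w = 0 the limit value is assigned. -/
theorem exists_eq_add_mul_of_differentiable {n : ℕ} {G : CSpace n → ℂ}
    (hG : ∀ᶠ s in 𝓝 (0 : CSpace n), DifferentiableAt ℂ G s) :
    ∃ β : CSpace n → ℂ, Tendsto β (𝓝 0) (𝓝 (fderiv ℂ G 0 (0, 1))) ∧
      ∀ s, G s = G (s.1, 0) + s.2 * β s := by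
  set A := fderiv ℂ G 0 (0, 1) with hA
  refine ⟨fun s => if s.2 = 0 then A else (G s - G (s.1, 0)) / s.2, ?_, fun s => ?_⟩
  · have ho := (hasStrictFDerivAt_of_eventually_differentiableAt hG).isLittleO
    have hcomp : Tendsto (fun s : CSpace n => (s, ((s.1, 0) : CSpace n))) (𝓝 0) (𝓝 (0, 0)) := by
      have : Continuous fun s : CSpace n => (s, ((s.1, 0) : CSpace n)) := by fun_prop
      exact this.tendsto' _ _ rfl
    have h := ho.comp_tendsto hcomp
    rw [Metric.tendsto_nhds]
    intro e he
    filter_upwards [h.def (half_pos he)] with s hs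
    rw [dist_eq_norm]
    split_ifs with h2
    · simpa using he
    · have hsub : s - (s.1, 0) = s.2 • ((0, 1) : CSpace n) := by
        ext <;> simp
      simp only [Function.comp_apply] at hs
      rw [hsub, map_smul, ← hA, norm_smul] at hs
      have h1 : ‖((0, 1) : CSpace n)‖ = 1 := by simp [Prod.norm_def]
      rw [h1, mul_one] at hs
      have h3 : (G s - G (s.1, 0)) / s.2 - A = (G s - G (s.1, 0) - s.2 • A) / s.2 := by
        rw [smul_eq_mul]; field_simp
      rw [h3, norm_div, div_lt_iff₀ (norm_pos_iff.2 h2)]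
      have := norm_pos_iff.2 h2
      nlinarith
  · dsimp only
    split_ifs with h2
    · rw [h2, zero_mul, add_zero, ← h2]
    · field_simp
      ring

theorem tendsto_sub_smul_of_hasFDerivAt {E F : Type*} [NormedAddCommGroup E] [NormedSpace ℂ E]
    [NormedAddCommGroup F] [NormedSpace ℂ F] {f : E → F} {f' : E →L[ℂ] F}
    (hf : HasFDerivAt f f' 0) (h0 : f 0 = 0) {v : ℝ → E} {v₀ : E}
    (hv : Tendsto v (𝓝[>] 0) (𝓝 v₀)) :
    Tendsto (fun ε : ℝ => (ε : ℂ)⁻¹ • f ((ε : ℂ) • v ε)) (𝓝[>] 0) (𝓝 (f' v₀)) := by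
  have hd : Tendsto (fun ε : ℝ => (ε : ℂ) • v ε) (𝓝[>] 0) (𝓝 0) := by
    simpa using tendsto_ofReal_nhdsGT_zero.smul hv
  have h := (hasFDerivWithinAt_univ.2 hf).lim (c := fun ε : ℝ => (ε : ℂ)⁻¹) hd
    (.of_forall fun _ => Set.mem_univ _) (v := v₀) (by
      refine hv.congr' ?_
      filter_upwards [self_mem_nhdsWithin] with ε hε
      have hε0 : (ε : ℂ) ≠ 0 := by exact_mod_cast (ne_of_gt hε)
      rw [inv_smul_smul₀ hε0])
  simpa [h0] using h

/-- The normal form `A w + b(z) + o_wt(1)` at the origin of a holomorphic function whose imaginary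
part is nonnegative on the hypersurface `v = P(z, z̄) + o_wt(1)`. -/
theorem exists_support_function_expansion {n m : ℕ} (hm : 2 ≤ m) {Ψ : (Fin n → ℂ) × ℝ → ℝ}
    {P : ZPoly n} (hP : P.IsHomogeneous m) (hΨ : IsLeadingPart (fun _ => 1 / (m : ℝ)) Ψ P)
    {G : CSpace n → ℂ} (hG : ∀ᶠ s in 𝓝 (0 : CSpace n), DifferentiableAt ℂ G s) (hG0 : G 0 = 0)
    (hG' : fderiv ℂ G 0 ≠ 0)
    (hpos : ∀ᶠ s in 𝓝 (0 : CSpace n), s.2.im = Ψ (s.1, s.2.re) → 0 ≤ (G s).im) :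
    ∃ (A : ℝ) (b : (Fin n → ℂ) → ℂ), A ≠ 0 ∧
      (∀ (c : Fin n → ℂ) (ζ : ℂ), b (ζ • c) = ζ ^ m * b c) ∧
      (∀ y, 0 ≤ A * (P.val y).re + (b y).im) ∧
      ∃ β : CSpace n → ℂ, Tendsto β (𝓝 0) (𝓝 A) ∧ (∀ s, G s = G (s.1, 0) + s.2 * β s) ∧
      ∀ (y : ℝ → Fin n → ℂ) (y₀ : Fin n → ℂ), Tendsto y (𝓝[>] 0) (𝓝 y₀) →
        Tendsto (fun ε : ℝ => G ((ε : ℂ) • y ε, 0) / (ε : ℂ) ^ m) (𝓝[>] 0) (𝓝 (b y₀)) := by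
  have hm0 : 0 < m := by omega
  obtain ⟨β, hβ, hGβ⟩ := exists_eq_add_mul_of_differentiable hG
  set A := fderiv ℂ G 0 (0, 1) with hA
  let h : (Fin n → ℂ) → ℂ := fun z => G (z, 0)
  have hincl : Tendsto (fun z : Fin n → ℂ => ((z, 0) : CSpace n)) (𝓝 0) (𝓝 0) := by
    have : Continuous fun z : Fin n → ℂ => ((z, 0) : CSpace n) := by fun_prop
    exact this.tendsto' _ _ rfl
  have hh : ∀ᶠ z in 𝓝 (0 : Fin n → ℂ), DifferentiableAt ℂ h z := by
    filter_upwards [hincl.eventually hG] with z hz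
    exact DifferentiableAt.comp z hz (by fun_prop)
  have hh0 : h 0 = 0 := hG0
  -- points of the hypersurface
  have hpt : ∀ (y : Fin n → ℂ) (r : ℝ), Tendsto (fun ε : ℝ => (((ε : ℂ) • y, (ε : ℂ) ^ m *
      (r + (Ψ ((ε : ℂ) • y, ε ^ m * r) / ε ^ m : ℝ) * Complex.I)) : CSpace n)) (𝓝[>] 0) (𝓝 0) ∧
      Tendsto (fun ε : ℝ => (r + (Ψ ((ε : ℂ) • y, ε ^ m * r) / ε ^ m : ℝ) * Complex.I : ℂ))
        (𝓝[>] 0) (𝓝 (r + (P.val y).re * Complex.I)) ∧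
      ∀ᶠ ε : ℝ in 𝓝[>] 0, 0 ≤ (G ((ε : ℂ) • y, (ε : ℂ) ^ m *
        (r + (Ψ ((ε : ℂ) • y, ε ^ m * r) / ε ^ m : ℝ) * Complex.I))).im := by
    intro y r
    have h1 := tendsto_graph_scaled hm0 hP hΨ (tendsto_const_nhds (x := y))
      (tendsto_const_nhds (x := r))
    have h2 : Tendsto (fun ε : ℝ => (r + (Ψ ((ε : ℂ) • y, ε ^ m * r) / ε ^ m : ℝ) * Complex.I : ℂ))
        (𝓝[>] 0) (𝓝 (r + (P.val y).re * Complex.I)) :=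
      (((Complex.continuous_ofReal.tendsto _).comp h1).mul_const _).const_add _
    have h3 := tendsto_smul_pow_mul_zero hm0 (tendsto_const_nhds (x := y)) h2
    refine ⟨h3, h2, ?_⟩
    filter_upwards [h3.eventually hpos, self_mem_nhdsWithin] with ε hε hε0
    have hε0 : ε ^ m ≠ 0 := pow_ne_zero _ (ne_of_gt hε0)
    apply hε
    rw [← Complex.ofReal_pow]
    simp only [Complex.im_ofReal_mul, Complex.re_ofReal_mul, Complex.add_im, Complex.add_re,
      Complex.ofReal_im, Complex.ofReal_re, Complex.I_re, Complex.I_im, mul_one, mul_zero,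
      add_zero, zero_add]
    rw [mul_div_cancel₀ _ hε0]
  -- vanishing order on lines
  have hlines : ∀ y : Fin n → ℂ, ∃ b : ℂ,
      (fun ζ : ℂ => h (ζ • y) - b * ζ ^ m) =o[𝓝 0] fun ζ => ζ ^ m := by
    intro y
    have hsm : Tendsto (fun ζ : ℂ => ζ • y) (𝓝 0) (𝓝 0) := by
      have : Continuous fun ζ : ℂ => ζ • y := by fun_prop
      exact this.tendsto' _ _ (zero_smul _ _)
    refine exists_leading_coeff_of_im_lower_bound (g := fun ζ => h (ζ • y)) ?_ (by simp [hh0]) ?_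
    · rw [Complex.analyticAt_iff_eventually_differentiableAt]
      filter_upwards [hsm.eventually hh] with ζ hζ
      exact DifferentiableAt.comp (g := h) ζ hζ (by fun_prop)
    -- On `M` over ε v y one has w = O(ε^m), so Im G ≥ 0 bounds Im h below by -|w β|. The constant
    -- is the limit of |w β| / ε^m, plus one.
    · intro v
      obtain ⟨h1, h2, h3⟩ := hpt (v • y) 0
      have h4 := (h2.mul (hβ.comp h1)).norm
      refine ⟨‖(((0 : ℝ) : ℂ) + (P.val (v • y)).re * Complex.I) * A‖ + 1, ?_⟩
      filter_upwards [h3, h4.eventually (Iio_mem_nhds (lt_add_one _)), self_mem_nhdsWithin]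
        with ε hε1 hε2 hε0
      have hε0 : 0 < ε := hε0
      rw [hGβ] at hε1
      simp only [Function.comp_apply] at hε2
      rw [Complex.add_im, mul_assoc, ← Complex.ofReal_pow, Complex.im_ofReal_mul] at hε1
      have h5 := (le_abs_self _).trans (Complex.abs_im_le_norm ((((0 : ℝ) : ℂ) +
        ((Ψ ((ε : ℂ) • (v • y), ε ^ m * 0) / ε ^ m : ℝ) : ℂ) * Complex.I) *
        β ((ε : ℂ) • (v • y), (ε : ℂ) ^ m * (((0 : ℝ) : ℂ) +
        ((Ψ ((ε : ℂ) • (v • y), ε ^ m * 0) / ε ^ m : ℝ) : ℂ) * Complex.I))))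
      have h6 := mul_le_mul_of_nonneg_left (h5.trans (le_of_lt hε2)) (pow_pos hε0 m).le
      simp only [h, mul_smul]
      simp only [Complex.ofReal_pow] at hε1 h6
      linarith
  choose b hb using hlines
  have hblow : ∀ (y : ℝ → Fin n → ℂ) (y₀ : Fin n → ℂ), Tendsto y (𝓝[>] 0) (𝓝 y₀) →
      Tendsto (fun ε : ℝ => G ((ε : ℂ) • y ε, 0) / (ε : ℂ) ^ m) (𝓝[>] 0) (𝓝 (b y₀)) :=
    fun y y₀ hy => tendsto_blowup_of_lines hh hm0 hb hy
  have hbhom : ∀ (c : Fin n → ℂ) (ζ : ℂ), b (ζ • c) = ζ ^ m * b c := by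
    intro c ζ
    have h1 := hblow (fun _ => ζ • c) _ tendsto_const_nhds
    have hζ : Tendsto (fun ε : ℝ => (ε : ℂ) * ζ) (𝓝[>] 0) (𝓝 0) := by
      simpa using tendsto_ofReal_nhdsGT_zero.mul_const ζ
    rcases eq_or_ne ζ 0 with rfl | hζ0
    · refine tendsto_nhds_unique h1 ?_
      rw [zero_pow hm0.ne', zero_mul]
      refine tendsto_const_nhds.congr fun ε => ?_
      rw [zero_smul, smul_zero, Prod.mk_zero_zero, hG0, zero_div]
    · have h2 := (((hb c).comp_tendsto hζ).tendsto_div_nhds_zero).add_const (b c)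
      have h3 := h2.const_mul (ζ ^ m)
      rw [zero_add] at h3
      refine tendsto_nhds_unique h1 (h3.congr' ?_)
      filter_upwards [self_mem_nhdsWithin] with ε hε
      have hε0 : (ε : ℂ) ≠ 0 := by exact_mod_cast (ne_of_gt hε)
      simp only [Function.comp_apply, h, mul_smul, mul_pow]
      field_simp
      ring
  have hb0 : b 0 = 0 := by
    have := hbhom 0 0
    rwa [smul_zero, zero_pow hm0.ne', zero_mul] at this
  -- The scaled limit of Im G ≥ 0 at the point of `M` with u = ε^m r.
  have hlim : ∀ (y : Fin n → ℂ) (r : ℝ),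
      0 ≤ (b y + (r + (P.val y).re * Complex.I) * A).im := by
    intro y r
    obtain ⟨h1, h2, h3⟩ := hpt y r
    have h4 := (hblow (fun _ => y) y tendsto_const_nhds).add (h2.mul (hβ.comp h1))
    refine ge_of_tendsto ((Complex.continuous_im.tendsto _).comp h4) ?_
    filter_upwards [h3, self_mem_nhdsWithin] with ε hε hε0
    have hε0 : 0 < ε := hε0
    have hε0' : (ε : ℂ) ^ m ≠ 0 := pow_ne_zero _ (by exact_mod_cast hε0.ne')
    rw [hGβ] at hε
    simp only [Function.comp_apply]
    have h5 := div_nonneg hε (pow_pos hε0 m).le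
    rw [← Complex.div_ofReal_im, Complex.ofReal_pow, add_div, mul_assoc,
      mul_div_cancel_left₀ _ hε0'] at h5
    exact h5
  have hP0 : P.val 0 = 0 := by
    have := ZPoly.val_smul hP 0 0
    rwa [smul_zero, Complex.ofReal_zero, zero_pow hm0.ne', zero_mul] at this
  -- At y = 0 the limit inequality is r Im A ≥ 0 for both signs of r.
  have hAim : A.im = 0 := by
    have h1 := hlim 0 1
    have h2 := hlim 0 (-1)
    rw [hb0, hP0] at h1 h2
    simp at h1 h2
    linarith
  have hAre : A = (A.re : ℂ) := by
    apply Complex.ext <;> simp [hAim]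
  refine ⟨A.re, b, ?_, hbhom, fun y => ?_, β, ?_, hGβ, hblow⟩
  -- As G(εz, 0) = O(ε^m) with m ≥ 2, the differential of G kills the z-directions; if A vanished it
  -- would be zero.
  · intro hA0
    apply hG'
    have hz : ∀ z : Fin n → ℂ, fderiv ℂ G 0 (z, 0) = 0 := by
      intro z
      have h1 := tendsto_sub_smul_of_hasFDerivAt hG.self_of_nhds.hasFDerivAt hG0
        (tendsto_const_nhds (x := ((z, 0) : CSpace n)))
      have h2 := ((tendsto_ofReal_nhdsGT_zero.pow (m - 1)).mul
        (hblow (fun _ => z) z tendsto_const_nhds))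
      rw [zero_pow (by omega), zero_mul] at h2
      refine tendsto_nhds_unique h1 (h2.congr' ?_)
      filter_upwards [self_mem_nhdsWithin] with ε hε
      have hε0 : (ε : ℂ) ≠ 0 := by exact_mod_cast (ne_of_gt hε)
      have hpow : (ε : ℂ) ^ m = (ε : ℂ) ^ (m - 1) * ε := by
        rw [← pow_succ, Nat.sub_add_cancel (by omega)]
      rw [Prod.smul_mk, smul_zero, hpow, smul_eq_mul]
      field_simp
    ext s
    · simpa using hz _
    · simpa [hA0] using hAre
  · have := hlim y 0
    rw [hAre] at this
    simp at this
    linarith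
  · rw [← hAre]; exact hβ

/-! ### Convex domains with boundary a graph -/

/-- The points below the graph are not in the closure of the convex domain. -/
theorem graph_le_of_mem_closure {n m : ℕ} (hm : 0 < m) {Ψ : (Fin n → ℂ) × ℝ → ℝ}
    (hΨc : ∀ᶠ x in 𝓝 (0 : (Fin n → ℂ) × ℝ), ContinuousAt Ψ x) (hΨ0 : Ψ 0 = 0)
    {F : CSpace n → CSpace n} (hF : ∀ᶠ s in 𝓝 (0 : CSpace n), ContinuousAt F s)
    {D : Set (CSpace n)} (hD : IsOpen D)
    (hgraph : ∀ᶠ s in 𝓝 (0 : CSpace n), (s.2.im = Ψ (s.1, s.2.re) ↔ F s ∈ frontier D))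
    (hout : ∀ᶠ ε : ℝ in 𝓝[>] 0, F (0, -(ε ^ m : ℝ) * Complex.I) ∉ D) :
    ∀ᶠ s in 𝓝 (0 : CSpace n), F s ∈ closure D → Ψ (s.1, s.2.re) ≤ s.2.im := by
  obtain ⟨r, hr, hball⟩ := Metric.eventually_nhds_iff_ball.1 (hF.and hgraph)
  have hΨsmall : ∀ᶠ x in 𝓝 (0 : (Fin n → ℂ) × ℝ), |Ψ x| < r / 4 := by
    have h := hΨc.self_of_nhds.abs
    rw [ContinuousAt, hΨ0, abs_zero] at h
    exact h.eventually (Iio_mem_nhds (by positivity))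
  obtain ⟨δ, hδ, hballΨ⟩ := Metric.eventually_nhds_iff_ball.1 (hΨc.and hΨsmall)
  set ρ := min δ (r / 4) with hρ
  have hρ0 : 0 < ρ := lt_min hδ (by positivity)
  let T : ((Fin n → ℂ) × ℝ) × ℝ → CSpace n := fun q =>
    (q.1.1, (q.1.2 : ℂ) + ((Ψ q.1 - q.2 : ℝ) : ℂ) * Complex.I)
  have hTim : ∀ q, (T q).2.im = Ψ q.1 - q.2 := fun q => by simp [T]
  have hTre : ∀ q, (T q).2.re = q.1.2 := fun q => by simp [T]
  -- `T` sends ((z, u), t) to the point at depth t below the graph, so `K` parametrizes a connected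
  -- one-sided neighbourhood.
  let K : Set (((Fin n → ℂ) × ℝ) × ℝ) := Metric.ball 0 ρ ×ˢ Set.Ioo 0 (r / 4)
  have hTK : ∀ q ∈ K, T q ∈ Metric.ball (0 : CSpace n) r := by
    rintro ⟨⟨z, u⟩, t⟩ ⟨hx, ht0, ht⟩
    have hΨx := (hballΨ _ (Metric.ball_subset_ball (min_le_left _ _) hx)).2
    dsimp only at hx ht0 ht hΨx
    rw [mem_ball_zero_iff, Prod.norm_def, max_lt_iff] at hx
    have hρr : ρ ≤ r / 4 := min_le_right _ _
    rw [mem_ball_zero_iff, Prod.norm_def, max_lt_iff]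
    refine ⟨by linarith [hx.1], ?_⟩
    refine (Complex.norm_le_abs_re_add_abs_im _).trans_lt ?_
    rw [hTim, hTre]
    dsimp only
    have h1 := hx.2
    dsimp only at h1
    rw [Real.norm_eq_abs] at h1
    have h2 := abs_sub (Ψ (z, u)) t
    rw [abs_of_pos ht0] at h2
    linarith
  have hcont : ContinuousOn (fun q => F (T q)) K := by
    intro q hq
    have h1 := (hball _ (hTK q hq)).1
    have h2 : ContinuousAt Ψ q.1 :=
      (hballΨ _ (Metric.ball_subset_ball (min_le_left _ _) hq.1)).1
    have h3 : ContinuousAt (fun q : ((Fin n → ℂ) × ℝ) × ℝ => Ψ q.1) q :=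
      ContinuousAt.comp (f := Prod.fst) h2 continuousAt_fst
    have h4 : ContinuousAt T q := by
      refine ContinuousAt.prodMk (by fun_prop) ?_
      refine ContinuousAt.add (by fun_prop) (ContinuousAt.mul ?_ continuousAt_const)
      exact Complex.continuous_ofReal.continuousAt.comp (h3.sub continuousAt_snd)
    exact (ContinuousAt.comp (f := T) h1 h4).continuousWithinAt
  have hconn : IsPreconnected ((fun q => F (T q)) '' K) :=
    ((convex_ball _ _).prod (convex_Ioo _ _)).isPreconnected.image _ hcont
  have hnf : ∀ q ∈ K, F (T q) ∉ frontier D := by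
    intro q hq hfr
    have h := (hball _ (hTK q hq)).2.2 hfr
    rw [hTim, hTre] at h
    change Ψ q.1 - q.2 = Ψ q.1 at h
    have := hq.2.1
    linarith
  -- The image of `K` is connected and misses the frontier, so one point in `D` would put all of it
  -- in `D`, against `hout`.
  have hnD : ∀ q ∈ K, F (T q) ∉ D := by
    intro q hq hqD
    have hsub : (fun q => F (T q)) '' K ⊆ D := by
      refine hconn.subset_of_closure_inter_subset hD ⟨_, ⟨q, hq, rfl⟩, hqD⟩ ?_
      rintro _ ⟨hcl, q', hq', rfl⟩
      by_contra hn
      exact hnf q' hq' ⟨hcl, fun hi => hn (interior_subset hi)⟩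
    have hsmall : ∀ᶠ ε : ℝ in 𝓝[>] 0, ε ^ m < r / 4 := by
      have : Tendsto (fun ε : ℝ => ε ^ m) (𝓝[>] 0) (𝓝 0) :=
        ((continuous_pow m).tendsto' 0 0 (zero_pow hm.ne')).mono_left nhdsWithin_le_nhds
      exact this.eventually (Iio_mem_nhds (by positivity))
    obtain ⟨ε, hε, hεr, hε0⟩ := (hout.and (hsmall.and self_mem_nhdsWithin)).exists
    apply hε
    have hmem : ((0, ε ^ m) : ((Fin n → ℂ) × ℝ) × ℝ) ∈ K :=
      ⟨Metric.mem_ball_self hρ0, pow_pos hε0 m, hεr⟩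
    have := hsub ⟨_, hmem, rfl⟩
    simpa [T, hΨ0] using this
  have hev : ∀ᶠ s in 𝓝 (0 : CSpace n), (s.1, s.2.re) ∈ Metric.ball (0 : (Fin n → ℂ) × ℝ) ρ ∧
      Ψ (s.1, s.2.re) - s.2.im < r / 4 := by
    have h1 : Tendsto (fun s : CSpace n => (s.1, s.2.re)) (𝓝 0) (𝓝 0) := by
      have : Continuous fun s : CSpace n => (s.1, s.2.re) := by fun_prop
      exact this.tendsto' _ _ rfl
    have h2 : Tendsto (fun s : CSpace n => Ψ (s.1, s.2.re) - s.2.im) (𝓝 0) (𝓝 0) := by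
      have h3 := hΨc.self_of_nhds.tendsto.comp h1
      rw [hΨ0] at h3
      have h4 : Tendsto (fun s : CSpace n => s.2.im) (𝓝 0) (𝓝 0) := by
        have : Continuous fun s : CSpace n => s.2.im := by fun_prop
        exact this.tendsto' _ _ rfl
      simpa using h3.sub h4
    exact (h1.eventually (Metric.ball_mem_nhds _ hρ0)).and
      (h2.eventually (Iio_mem_nhds (by positivity)))
  filter_upwards [hev] with s hs hcl
  by_contra! hlt
  let q : ((Fin n → ℂ) × ℝ) × ℝ := ((s.1, s.2.re), Ψ (s.1, s.2.re) - s.2.im)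
  have hq : q ∈ K := ⟨hs.1, by simp only [q]; linarith, hs.2⟩
  have hTq : T q = s := by
    refine Prod.ext rfl (Complex.ext ?_ ?_)
    · rw [hTre]
    · rw [hTim]; simp [q]
  have h1 := hnD q hq
  have h2 := hnf q hq
  rw [hTq] at h1 h2
  rw [closure_eq_self_union_frontier] at hcl
  exact hcl.elim h1 h2

/-- If the hypersurface `v = P(z, z̄) + o_wt(1)` is mapped by local holomorphic coordinates into the
boundary of a convex domain, then, up to a nonzero real factor and the addition of a pluriharmonic
term, the leading polynomial `P` is convex. -/
theorem exists_convex_leading_polynomial {n m : ℕ} (hm : 2 ≤ m) {Ψ : (Fin n → ℂ) × ℝ → ℝ}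
    {P : ZPoly n} (hP : P.IsHomogeneous m) (hΨ : IsLeadingPart (fun _ => 1 / (m : ℝ)) Ψ P)
    (hΨc : ∀ᶠ x in 𝓝 (0 : (Fin n → ℂ) × ℝ), ContinuousAt Ψ x)
    {F E : CSpace n → CSpace n} (hF : ∀ᶠ s in 𝓝 (0 : CSpace n), DifferentiableAt ℂ F s)
    (hE : DifferentiableAt ℂ E 0) (hF0 : F 0 = 0) (hE0 : E 0 = 0)
    (hEF : ∀ᶠ s in 𝓝 (0 : CSpace n), E (F s) = s) (hFE : ∀ᶠ s in 𝓝 (0 : CSpace n), F (E s) = s)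
    {D : Set (CSpace n)} (hD : IsOpen D) (hconv : Convex ℝ D) (h0D : (0 : CSpace n) ∈ frontier D)
    (hgraph : ∀ᶠ s in 𝓝 (0 : CSpace n), (s.2.im = Ψ (s.1, s.2.re) ↔ F s ∈ frontier D)) :
    ∃ (A : ℝ) (b : (Fin n → ℂ) → ℂ), A ≠ 0 ∧
      (∀ (c : Fin n → ℂ) (ζ : ℂ), b (ζ • c) = ζ ^ m * b c) ∧
      (∀ y, 0 ≤ A * (P.val y).re + (b y).im) ∧
      (0 < A → ∀ y t, 2 * (A * (P.val y).re + (b y).im) ≤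
        (A * (P.val (y + t)).re + (b (y + t)).im) + (A * (P.val (y - t)).re + (b (y - t)).im)) := by
  have hm0 : 0 < m := by omega
  have h0D' : (0 : CSpace n) ∉ D := fun h => h0D.2 (by rwa [hD.interior_eq])
  obtain ⟨f, hf⟩ := RCLike.geometric_hahn_banach_open_point (𝕜 := ℂ) hconv hD h0D'
  -- Re f < 0 on `D`; multiplying by -i turns this into Im ℓ > 0.
  set ℓ : CSpace n →L[ℂ] ℂ := (-Complex.I) • f with hℓ
  have hℓD : ∀ x ∈ D, 0 < (ℓ x).im := by
    intro x hx
    have := hf x hx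
    rw [map_zero] at this
    simpa [hℓ] using this
  have hℓcl : ∀ x ∈ closure D, 0 ≤ (ℓ x).im := by
    intro x hx
    have hcl : IsClosed {x : CSpace n | 0 ≤ (ℓ x).im} :=
      isClosed_le continuous_const (Complex.continuous_im.comp ℓ.continuous)
    exact closure_minimal (fun y hy => (hℓD y hy).le) hcl hx
  have hFd := hF.self_of_nhds.hasFDerivAt
  have hEd := hE.hasFDerivAt
  set L := fderiv ℂ F 0
  set L' := fderiv ℂ E 0
  have hL'L : ∀ v, L' (L v) = v := by
    have h1 : HasFDerivAt (E ∘ F) (L'.comp L) 0 := HasFDerivAt.comp 0 (by rwa [hF0]) hFd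
    have h2 : HasFDerivAt (E ∘ F) (ContinuousLinearMap.id ℂ (CSpace n)) 0 :=
      (hasFDerivAt_id 0).congr_of_eventuallyEq hEF
    exact fun v => DFunLike.congr_fun (h1.unique h2) v
  have hLL' : ∀ v, L (L' v) = v := by
    have h1 : HasFDerivAt (F ∘ E) (L.comp L') 0 := HasFDerivAt.comp 0 (by rwa [hE0]) hEd
    have h2 : HasFDerivAt (F ∘ E) (ContinuousLinearMap.id ℂ (CSpace n)) 0 :=
      (hasFDerivAt_id 0).congr_of_eventuallyEq hFE
    exact fun v => DFunLike.congr_fun (h1.unique h2) v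
  let G : CSpace n → ℂ := fun s => ℓ (F s)
  have hG : ∀ᶠ s in 𝓝 (0 : CSpace n), DifferentiableAt ℂ G s := by
    filter_upwards [hF] with s hs
    exact ℓ.differentiableAt.comp s hs
  have hG0 : G 0 = 0 := by simp [G, hF0]
  have hG' : fderiv ℂ G 0 ≠ 0 := by
    intro h0
    have h1 : HasFDerivAt G (ℓ.comp L) 0 := ℓ.hasFDerivAt.comp 0 hFd
    obtain ⟨x, hx⟩ : D.Nonempty := closure_nonempty_iff.1 ⟨0, h0D.1⟩
    have h2 := DFunLike.congr_fun (h1.fderiv.symm.trans h0) (L' x)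
    simp only [ContinuousLinearMap.comp_apply, hLL', zero_apply] at h2
    have := hℓD x hx
    rw [h2] at this
    simp at this
  have hpos : ∀ᶠ s in 𝓝 (0 : CSpace n), s.2.im = Ψ (s.1, s.2.re) → 0 ≤ (G s).im := by
    filter_upwards [hgraph] with s hs h
    exact hℓcl _ (hs.1 h).1
  obtain ⟨A, b, hA, hbhom, hq, β, hβ, hGβ, hblow⟩ :=
    exists_support_function_expansion hm hP hΨ hG hG0 hG' hpos
  refine ⟨A, b, hA, hbhom, hq, fun hApos y t => ?_⟩
  have hΨ0 : Ψ 0 = 0 := by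
    have := hgraph.self_of_nhds.2 (by rwa [hF0])
    exact this.symm
  have hb0 : b 0 = 0 := by
    have := hbhom 0 0
    rwa [smul_zero, zero_pow hm0.ne', zero_mul] at this
  have hexp : ∀ (y : ℝ → Fin n → ℂ) (y₀ : Fin n → ℂ) (w : ℝ → ℂ) (w₀ : ℂ),
      Tendsto y (𝓝[>] 0) (𝓝 y₀) → Tendsto w (𝓝[>] 0) (𝓝 w₀) →
      Tendsto (fun ε : ℝ => G ((ε : ℂ) • y ε, (ε : ℂ) ^ m * w ε) / (ε : ℂ) ^ m) (𝓝[>] 0)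
        (𝓝 (b y₀ + w₀ * A)) := by
    intro y y₀ w w₀ hy hw
    refine ((hblow y y₀ hy).add
      (hw.mul (hβ.comp (tendsto_smul_pow_mul_zero hm0 hy hw)))).congr' ?_
    filter_upwards [self_mem_nhdsWithin] with ε hε
    have hε0 : (ε : ℂ) ^ m ≠ 0 := pow_ne_zero _ (by exact_mod_cast (ne_of_gt hε))
    simp only [Function.comp_apply]
    rw [hGβ ((ε : ℂ) • y ε, (ε : ℂ) ^ m * w ε), add_div, mul_assoc ((ε : ℂ) ^ m), mul_div_cancel_left₀ _ hε0]
  -- At (0, -iε^m) the scaled Im G tends to -A < 0, so points directly below the origin are not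
  -- mapped into `D`. This is where A > 0 fixes the side of `M`.
  have hside := graph_le_of_mem_closure hm0 hΨc hΨ0 (hF.mono fun s hs => hs.continuousAt) hD hgraph
    (by
      have h1 := hexp (fun _ => 0) 0 (fun _ => -Complex.I) (-Complex.I) tendsto_const_nhds
        tendsto_const_nhds
      have h2 := ((Complex.continuous_im.tendsto _).comp h1).eventually
        (Iio_mem_nhds (show (b 0 + -Complex.I * A).im < 0 by simp [hb0, hApos]))
      filter_upwards [h2, self_mem_nhdsWithin] with ε hε hε0 hmem
      have h3 := div_pos (hℓD _ hmem) (pow_pos hε0 m)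
      have h4 : ((0 : Fin n → ℂ), -((ε ^ m : ℝ) : ℂ) * Complex.I) =
          ((ε : ℂ) • (0 : Fin n → ℂ), (ε : ℂ) ^ m * -Complex.I) := by
        rw [smul_zero]; push_cast; ring_nf
      rw [h4, ← Complex.div_ofReal_im, Complex.ofReal_pow] at h3
      exact absurd h3 (not_lt.2 (le_of_lt hε)))
  -- boundary points and their images
  have hpt : ∀ x : Fin n → ℂ, ∃ s : ℝ → CSpace n, Tendsto s (𝓝[>] 0) (𝓝 0) ∧
      (∀ᶠ ε in 𝓝[>] 0, F (s ε) ∈ closure D) ∧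
      Tendsto (fun ε : ℝ => G (s ε) / (ε : ℂ) ^ m) (𝓝[>] 0)
        (𝓝 (b x + (P.val x).re * Complex.I * A)) ∧
      Tendsto (fun ε : ℝ => (ε : ℂ)⁻¹ • F (s ε)) (𝓝[>] 0) (𝓝 (L (x, 0))) := by
    intro x
    have h1 := tendsto_graph_scaled hm0 hP hΨ (tendsto_const_nhds (x := x))
      (tendsto_const_nhds (x := (0 : ℝ)))
    have h2 : Tendsto (fun ε : ℝ => ((Ψ ((ε : ℂ) • x, ε ^ m * 0) / ε ^ m : ℝ) * Complex.I : ℂ))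
        (𝓝[>] 0) (𝓝 ((P.val x).re * Complex.I)) :=
      ((Complex.continuous_ofReal.tendsto _).comp h1).mul_const _
    have h3 := tendsto_smul_pow_mul_zero hm0 (tendsto_const_nhds (x := x)) h2
    refine ⟨_, h3, ?_, hexp _ _ _ _ tendsto_const_nhds h2, ?_⟩
    · filter_upwards [h3.eventually hgraph, self_mem_nhdsWithin] with ε hε hε0
      have hε0 : ε ^ m ≠ 0 := pow_ne_zero _ (ne_of_gt hε0)
      refine (hε.1 ?_).1
      rw [← Complex.ofReal_pow]
      simp only [Complex.im_ofReal_mul, Complex.re_ofReal_mul, Complex.I_re, Complex.I_im, mul_one,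
        mul_zero]
      rw [mul_div_cancel₀ _ hε0]
    -- The boundary point is ε (x, O(ε^(m-1))), and m ≥ 2 makes its w-component disappear to first
    -- order.
    · have h4 : Tendsto (fun ε : ℝ => ((x, (ε : ℂ) ^ (m - 1) *
          ((Ψ ((ε : ℂ) • x, ε ^ m * 0) / ε ^ m : ℝ) * Complex.I)) : CSpace n)) (𝓝[>] 0)
          (𝓝 (x, 0)) := by
        have := (tendsto_ofReal_nhdsGT_zero.pow (m - 1)).mul h2
        rw [zero_pow (by omega), zero_mul] at this
        exact tendsto_const_nhds.prodMk_nhds this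
      refine (tendsto_sub_smul_of_hasFDerivAt hFd hF0 h4).congr fun ε => ?_
      congr 2
      rw [Prod.smul_mk, smul_eq_mul, ← mul_assoc, ← pow_succ', Nat.sub_add_cancel (by omega)]
  obtain ⟨s₁, hs₁, hcl₁, hG₁, hL₁⟩ := hpt (y + t)
  obtain ⟨s₂, hs₂, hcl₂, hG₂, hL₂⟩ := hpt (y - t)
  -- the midpoint
  let X : ℝ → CSpace n := fun ε => (2⁻¹ : ℝ) • F (s₁ ε) + (2⁻¹ : ℝ) • F (s₂ ε)
  have hXcl : ∀ᶠ ε in 𝓝[>] 0, X ε ∈ closure D := by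
    filter_upwards [hcl₁, hcl₂] with ε h1 h2
    exact hconv.closure h1 h2 (by norm_num) (by norm_num) (by norm_num)
  have hXlim : Tendsto (fun ε : ℝ => (ε : ℂ)⁻¹ • X ε) (𝓝[>] 0) (𝓝 (L (y, 0))) := by
    have h1 := (hL₁.const_smul (2⁻¹ : ℝ)).add (hL₂.const_smul (2⁻¹ : ℝ))
    have h2 : (2⁻¹ : ℝ) • L (y + t, 0) + (2⁻¹ : ℝ) • L (y - t, 0) = L (y, 0) := by
      have h3 : ((y + t, 0) : CSpace n) + (y - t, 0) = (2 : ℝ) • (y, 0) := by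
        ext <;> simp [two_mul]
      rw [← smul_add, ← map_add, h3, ContinuousLinearMap.map_smul_of_tower, inv_smul_smul₀ two_ne_zero]
    rw [h2] at h1
    refine h1.congr fun ε => ?_
    simp only [X]
    rw [smul_add, smul_comm (ε : ℂ)⁻¹, smul_comm (ε : ℂ)⁻¹]
  have hYlim : Tendsto (fun ε : ℝ => (ε : ℂ)⁻¹ • E (X ε)) (𝓝[>] 0) (𝓝 (y, 0)) := by
    have h1 := tendsto_sub_smul_of_hasFDerivAt hEd hE0 hXlim
    rw [hL'L] at h1
    refine h1.congr' ?_
    filter_upwards [self_mem_nhdsWithin] with ε hε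
    have hε0 : (ε : ℂ) ≠ 0 := by exact_mod_cast (ne_of_gt hε)
    rw [smul_inv_smul₀ hε0]
  have hX0 : Tendsto X (𝓝[>] 0) (𝓝 0) := by
    have h1 := tendsto_ofReal_nhdsGT_zero.smul hXlim
    rw [zero_smul] at h1
    refine h1.congr' ?_
    filter_upwards [self_mem_nhdsWithin] with ε hε
    have hε0 : (ε : ℂ) ≠ 0 := by exact_mod_cast (ne_of_gt hε)
    rw [smul_inv_smul₀ hε0]
  let Y : ℝ → CSpace n := fun ε => E (X ε)
  have hY0 : Tendsto Y (𝓝[>] 0) (𝓝 0) := by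
    have := hE.continuousAt.tendsto.comp hX0
    rwa [hE0] at this
  let η : ℝ → Fin n → ℂ := fun ε => (ε : ℂ)⁻¹ • (Y ε).1
  let w : ℝ → ℂ := fun ε => (Y ε).2 / (ε : ℂ) ^ m
  have hη : Tendsto η (𝓝[>] 0) (𝓝 y) := (continuous_fst.tendsto _).comp hYlim
  have hYeq : ∀ ε : ℝ, 0 < ε → Y ε = ((ε : ℂ) • η ε, (ε : ℂ) ^ m * w ε) := by
    intro ε hε
    have hε0 : (ε : ℂ) ≠ 0 := by exact_mod_cast hε.ne'
    refine Prod.ext ?_ ?_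
    · simp only [η, smul_inv_smul₀ hε0]
    · simp only [w, mul_div_cancel₀ _ (pow_ne_zero m hε0)]
  -- Since ℓ is linear, G at the preimage of the midpoint is the mean of its values at the two
  -- boundary points.
  set g : ℂ := (2⁻¹ : ℝ) • (b (y + t) + (P.val (y + t)).re * Complex.I * A)
    + (2⁻¹ : ℝ) • (b (y - t) + (P.val (y - t)).re * Complex.I * A) with hg
  have hGY : Tendsto (fun ε : ℝ => G (Y ε) / (ε : ℂ) ^ m) (𝓝[>] 0) (𝓝 g) := by
    refine ((hG₁.const_smul (2⁻¹ : ℝ)).add (hG₂.const_smul (2⁻¹ : ℝ))).congr' ?_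
    filter_upwards [hX0.eventually hFE] with ε hε
    simp only [G, Y, hε, X, map_add, ContinuousLinearMap.map_smul_of_tower, add_div, smul_div_assoc]
  -- First-order data locate only the z-component of the midpoint's preimage. Its w-component, of
  -- size ε^m, is recovered by solving G = G(z, 0) + w β for w.
  have hw : Tendsto w (𝓝[>] 0) (𝓝 ((g - b y) / A)) := by
    have hA' : (A : ℂ) ≠ 0 := by exact_mod_cast hA
    have hβY := hβ.comp hY0
    refine ((hGY.sub (hblow η y hη)).div hβY hA').congr' ?_
    filter_upwards [self_mem_nhdsWithin, hβY.eventually_ne hA'] with ε hε hβε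
    have hε0 : (ε : ℂ) ^ m ≠ 0 := pow_ne_zero _ (by exact_mod_cast (ne_of_gt hε))
    have h1 : ((ε : ℂ) • η ε) = (Y ε).1 := (congrArg Prod.fst (hYeq ε hε)).symm
    simp only [Pi.div_apply, Function.comp_apply] at hβε ⊢
    rw [h1, hGβ (Y ε), ← sub_div, add_sub_cancel_left]
    simp only [w]
    field_simp
  have hΨY := tendsto_graph_scaled hm0 hP hΨ hη ((Complex.continuous_re.tendsto _).comp hw)
  have hle := le_of_tendsto_of_tendsto hΨY ((Complex.continuous_im.tendsto _).comp hw) (by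
    filter_upwards [self_mem_nhdsWithin, hXcl, hX0.eventually hFE, hY0.eventually hside]
      with ε hε hcl hFEε hsideε
    have hε : 0 < ε := hε
    have h1 : Ψ ((Y ε).1, (Y ε).2.re) ≤ (Y ε).2.im := by
      apply hsideε
      simp only [Y, hFEε]
      exact hcl
    rw [hYeq ε hε, ← Complex.ofReal_pow] at h1
    simp only [Complex.im_ofReal_mul, Complex.re_ofReal_mul] at h1
    simp only [Function.comp_apply]
    rw [div_le_iff₀ (pow_pos hε m), mul_comm (w ε).im]
    exact h1)
  rw [Complex.div_ofReal_im, le_div_iff₀ hApos, hg] at hle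
  simp at hle
  linarith

/-! ### Kohn-Nirenberg numbers of convexifiable hypersurfaces -/

theorem HolCoords.tendsto_symm {n : ℕ} {p : CSpace n} (Φ : HolCoords n p) :
    Tendsto Φ.chart.symm (𝓝 0) (𝓝 p) := by
  have h := Φ.chart.symm.continuousAt (x := 0)
    (by rw [← Φ.map_center]; exact Φ.chart.map_source Φ.mem_source)
  have h2 : Φ.chart.symm 0 = p := by rw [← Φ.map_center, Φ.chart.left_inv Φ.mem_source]
  rwa [ContinuousAt, h2] at h

theorem HolCoords.symm_zero {n : ℕ} {p : CSpace n} (Φ : HolCoords n p) :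
    Φ.chart.symm 0 = p := by
  rw [← Φ.map_center, Φ.chart.left_inv Φ.mem_source]

theorem HolCoords.eventually_mem_target {n : ℕ} {p : CSpace n} (Φ : HolCoords n p) :
    ∀ᶠ s in 𝓝 (0 : CSpace n), s ∈ Φ.chart.target :=
  Φ.chart.open_target.mem_nhds (by rw [← Φ.map_center]; exact Φ.chart.map_source Φ.mem_source)

theorem HolCoords.eventually_differentiableAt_transition {n : ℕ} {p : CSpace n}
    (Φ Φ' : HolCoords n p) :
    ∀ᶠ s in 𝓝 (0 : CSpace n), DifferentiableAt ℂ (fun s => Φ'.chart (Φ.chart.symm s)) s := by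
  filter_upwards [Φ.eventually_mem_target,
    Φ.tendsto_symm.eventually (Φ'.chart.open_source.mem_nhds Φ'.mem_source)] with s hs hs'
  exact DifferentiableAt.comp s (Φ'.holomorphic.differentiableAt (Φ'.chart.open_source.mem_nhds hs'))
    (Φ.holomorphic_symm.differentiableAt (Φ.chart.open_target.mem_nhds hs))

theorem HolCoords.eventually_transition_inverse {n : ℕ} {p : CSpace n} (Φ Φ' : HolCoords n p) :
    ∀ᶠ s in 𝓝 (0 : CSpace n),
      Φ.chart (Φ'.chart.symm (Φ'.chart (Φ.chart.symm s))) = s := by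
  filter_upwards [Φ.eventually_mem_target,
    Φ.tendsto_symm.eventually (Φ'.chart.open_source.mem_nhds Φ'.mem_source)] with s hs hs'
  rw [Φ'.chart.left_inv hs', Φ.chart.right_inv hs]

/-- In coordinates adapted to the weight `(1/m, …, 1/m)`, the leading polynomial of a locally
convexifiable hypersurface is, up to a nonzero factor and a pluriharmonic term, convex. -/
theorem exists_convex_leading_polynomial_of_convexifiable {n m : ℕ} (hm : 2 ≤ m)
    {M : Set (CSpace n)} {p : CSpace n} (hp : p ∈ M) (hconv : IsLocallyConvexifiableAt M p)
    {Φ : HolCoords n p} {P : ZPoly n} (hΦ : IsAdapted M p (fun _ => 1 / (m : ℝ)) Φ P) :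
    ∃ (A : ℝ) (b : (Fin n → ℂ) → ℂ), A ≠ 0 ∧
      (∀ (c : Fin n → ℂ) (ζ : ℂ), b (ζ • c) = ζ ^ m * b c) ∧
      (∀ y, 0 ≤ A * (P.val y).re + (b y).im) ∧
      (0 < A → ∀ y t, 2 * (A * (P.val y).re + (b y).im) ≤
        (A * (P.val (y + t)).re + (b (y + t)).im) +
          (A * (P.val (y - t)).re + (b (y - t)).im)) := by
  obtain ⟨-, hhom, -, Ψ, ⟨hΨs, hgraph⟩, hΨ⟩ := hΦ
  obtain ⟨Φ', D, hD, hDconv, hfr⟩ := hconv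
  refine exists_convex_leading_polynomial hm (isHomogeneous_of_constant_weight (by omega) hhom) hΨ
    (hΨs.mono fun x hx => hx.continuousAt)
    (F := fun s => Φ'.chart (Φ.chart.symm s)) (E := fun s => Φ.chart (Φ'.chart.symm s))
    (Φ.eventually_differentiableAt_transition Φ')
    (Φ'.eventually_differentiableAt_transition Φ).self_of_nhds
    (by simp only [Φ.symm_zero, Φ'.map_center]) (by simp only [Φ'.symm_zero, Φ.map_center])
    (Φ.eventually_transition_inverse Φ') (Φ'.eventually_transition_inverse Φ) hD hDconv ?_ ?_
  · rw [← Φ'.map_center]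
    exact hfr.self_of_nhds.1 hp
  · filter_upwards [Φ.tendsto_symm.eventually (hgraph.and hfr), Φ.eventually_mem_target]
      with s hs hst
    rw [Φ.chart.right_inv hst] at hs
    exact hs.1.symm.trans hs.2

/-- The correction Im b(ζc) = Im(ζ^m b(c)) changes only the coefficient of ζ^m, so the ratio |a_l| /
a_0 for l < m can be read off the convex function A P + Im b. -/
theorem kohnNirenberg_bound_of_convexifiable {n μ l : ℕ} (hl : 0 < l) (hlμ : l < μ)
    {M : Set (CSpace n)} {p : CSpace n} (hp : p ∈ M) (hconv : IsLocallyConvexifiableAt M p)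
    {Φ : HolCoords n p} {P : ZPoly n}
    (hΦ : IsAdapted M p (fun _ => 1 / ((2 * μ : ℕ) : ℝ)) Φ P) {c : Fin n → ℂ}
    (h0 : 0 < P.a₀ (2 * μ) c) :
    (μ < 2 * l → ‖P.aCoeff (2 * μ) (2 * l) c‖ / P.a₀ (2 * μ) c ≤ gammaKN (2 * l) (2 * μ)) ∧
      ‖P.aCoeff (2 * μ) (2 * l) c‖ / P.a₀ (2 * μ) c ≤ 2 * gammaKN (2 * l) (2 * μ) := by
  obtain ⟨A, b, hA, hbhom, hpos, hmid⟩ :=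
    exists_convex_leading_polynomial_of_convexifiable (by omega) hp hconv hΦ
  have hhom := isHomogeneous_of_constant_weight (by omega) hΦ.2.1
  -- The extra term encodes Im(b(c) ζ^m) = Re(-i b(c) ζ^m). `C` need not be conjugate symmetric at
  -- the extreme indices; only μ ± l with l < μ matter.
  let C : ℕ → ℂ := fun a => A * P.lineCoeff c a (2 * μ - a) +
    if a = 2 * μ then -Complex.I * b c else 0
  have hC : ∀ a, a < 2 * μ → C a = A * P.lineCoeff c a (2 * μ - a) := fun a ha => by
    simp only [C, if_neg ha.ne, add_zero]
  have hline : ∀ ζ : ℂ, lineFun (2 * μ) C ζ = A * (P.val (ζ • c)).re + (b (ζ • c)).im := by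
    intro ζ
    rw [hbhom, ZPoly.val_smul_eq_sum_lineCoeff hhom, ← Complex.re_ofReal_mul, Finset.mul_sum]
    simp only [lineFun, C, add_mul, Finset.sum_add_distrib, ite_mul, zero_mul]
    rw [Finset.sum_ite_eq', if_pos (by simp), Complex.add_re]
    congr 1
    · simp only [mul_assoc]
    · rw [Nat.sub_self, pow_zero, mul_one]
      simp
      ring
  have hCμ : (C μ).re = A * P.a₀ (2 * μ) c := by
    rw [hC μ (by omega), Complex.re_ofReal_mul, ZPoly.a₀, show 2 * μ / 2 = μ by omega,
      show 2 * μ - μ = μ by omega]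
  -- The mean of the nonnegative function A P + Im b over the circle is A a_0^c.
  have hApos : 0 < A := by
    have h1 := lineFun_unit_nonneg_zero_frequency (μ := μ) (by omega) (C := C) fun ζ => by
      rw [hline]; exact hpos _
    rw [hCμ] at h1
    exact lt_of_le_of_ne (nonneg_of_mul_nonneg_left h1 h0) hA.symm
  have hconvC : ∀ ζ t, 2 * lineFun (2 * μ) C ζ ≤
      lineFun (2 * μ) C (ζ + t) + lineFun (2 * μ) C (ζ - t) := by
    intro ζ t
    rw [hline, hline, hline, add_smul, sub_smul]
    exact hmid hApos _ _
  have hsymm : C (μ - l) = conj (C (μ + l)) := by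
    rw [hC _ (by omega), hC _ (by omega), map_mul, Complex.conj_ofReal,
      ← ZPoly.lineCoeff_conj hhom hΦ.1 c (show μ + l ≤ 2 * μ by omega),
      show 2 * μ - (μ + l) = μ - l by omega, show 2 * μ - (μ - l) = μ + l by omega]
  have hratio : 2 * ‖C (μ + l)‖ / (C μ).re =
      ‖P.aCoeff (2 * μ) (2 * l) c‖ / P.a₀ (2 * μ) c := by
    rw [hCμ, hC _ (by omega), ZPoly.aCoeff, norm_mul, norm_mul, Complex.norm_of_nonneg hApos.le,
      show (2 * μ + 2 * l) / 2 = μ + l by omega, show (2 * μ - 2 * l) / 2 = μ - l by omega,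
      show 2 * μ - (μ + l) = μ - l by omega, Complex.norm_ofNat]
    field_simp
  have hCpos : 0 < (C μ).re := by rw [hCμ]; exact mul_pos hApos h0
  rw [← hratio]
  exact ⟨fun hμ => coeff_le_gammaKN_of_lt hl hlμ hμ hsymm hCpos hconvC,
    coeff_le_two_mul_gammaKN hl hlμ hsymm hCpos hconvC⟩

theorem exists_of_lt_kappa {n m l : ℕ} {P : ZPoly n} {r : ℝ} (h : (r : EReal) < kappa P m l) :
    ∃ c : Fin n → ℂ, 0 < P.a₀ m c ∧ r < ‖P.aCoeff m l c‖ / P.a₀ m c := by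
  unfold kappa at h
  simp only [lt_iSup_iff] at h
  obtain ⟨c, -, h0, h⟩ := h
  exact ⟨c, h0, EReal.coe_lt_coe_iff.1 h⟩

end KohnNirenberg

/-! ### Contradiction with the assumed lower bound on the Kohn-Nirenberg number -/

theorem proposition6p1 (n m : ℕ) (hm : Even m)
    (M : Set (KohnNirenberg.CSpace n)) (p : KohnNirenberg.CSpace n) (hp : p ∈ M)
    (hM : KohnNirenberg.IsPseudoconvexAt M p)
    (hmt : KohnNirenberg.HasMultitype M p (fun _ => (m : ENNReal)))
    (Φ : KohnNirenberg.HolCoords n p) (P : KohnNirenberg.ZPoly n)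
    (hΦ : KohnNirenberg.IsAdapted M p (fun _ => 1 / (m : ℝ)) Φ P)
    (hκ : ∃ l : ℕ, Even l ∧ 2 ≤ l ∧ l < m ∧
      ((m < 2 * l ∧ (KohnNirenberg.gammaKN l m : EReal) < KohnNirenberg.kappa P m l) ∨
       (2 * l ≤ m ∧ ((2 * KohnNirenberg.gammaKN l m : ℝ) : EReal) < KohnNirenberg.kappa P m l))) :
    ¬ KohnNirenberg.IsLocallyConvexifiableAt M p := by
  intro hconv
  obtain ⟨μ, rfl⟩ := hm.two_dvd
  obtain ⟨l, hl, hl2, hlm, h⟩ := hκ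
  obtain ⟨k, rfl⟩ := hl.two_dvd
  rcases h with ⟨hlt, h⟩ | ⟨-, h⟩
  · obtain ⟨c, h0, hc⟩ := KohnNirenberg.exists_of_lt_kappa h
    exact absurd ((KohnNirenberg.kohnNirenberg_bound_of_convexifiable (by omega) (by omega) hp hconv
      hΦ h0).1 (by omega)) (not_le.2 hc)
  · obtain ⟨c, h0, hc⟩ := KohnNirenberg.exists_of_lt_kappa h
    exact absurd (KohnNirenberg.kohnNirenberg_bound_of_convexifiable (by omega) (by omega) hp hconv
      hΦ h0).2 (not_le.2 hc)
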